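/- **Setting.** A two-objective parity game consists of a finite vertex set $V=V^0\uplus V^1$ (with $n=|V|$), edges $E\subseteq V\times V$ such that every vertex has a successor, and two priority functions $P_0,P_1:V\to\mathbb N$ (player $i$ wants the highest priority seen infinitely often with respect to $P_i$ to be even). For $X\subseteq V$ all procedures below may be run on the restriction $G|_X$, which may have dead ends. A *template* is a triple $(S,D,\mathcal H)$ of unsafe edges, co-live edges, and a set of pairs $(R,H_\ell)$ with $R\subseteq V$ and $H_\ell$ a set of live-groups (sets of edges); templates are conjoined by componentwise union. $\mathrm{Parity}_{0,1}$, $\mathrm{B\ddot uchi}_{0,1}$, $\mathrm{Safety}_{0,1}$ denote the sets of vertices from which some infinite path of the current graph satisfies the respective objective. $\mathrm{pre}(U)$ is the set of vertices with a successor in $U$, and $\mathrm{cpre}^a(U)$ is the set of vertices of player $a$ with some successor in $U$ together with the vertices of player $1-a$ all of whose successors are in $U$. **$\mathrm{Attr}_a(G,U)$.** Put $A_0=U$ and $A_k=A_{k-1}\cup\mathrm{cpre}^a(A_{k-1})$. Return $\bigcup_k A_k\setminus U$ and, for each $k>0$, the live-group $E\cap((A_k\cap V^a)\times A_{k-1})$.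 **$\mathrm{Live}(G,I,i)$.** Start with $U=I$. While $U\neq V$: let $(W,H)=\mathrm{Attr}_i(G,U)$, add $H$ to $H^s$, add $W$ to $U$, let $C=\mathrm{cpre}^{1-i}(U)$, add the live-group $E\cap((C\cap V^{1-i})\times U)$ to $H^a$, and add $C$ to $U$. Return $(H^s,H^a)$. **$\mathrm{CoLive}(G,I,i)$.** Let $U=\mathrm{Safety}_{0,1}(G,I)$ and $D=E\cap(U\times(V\setminus U))$. While $U\ne V$: let $N=\mathrm{pre}(U)\setminus U$, add $E\cap(N\times N)$ to $D$, add $N$ to $U$, and add $E\cap(U\times(V\setminus U))$ to $D$. Return the edges of $D$ with source in $V^i$ and those with source in $V^{1-i}$, as $(D^s,D^a)$. **$\mathrm{ParityTemp}(G,P,i)$.** Let $W=\mathrm{Parity}_{0,1}(G,P)$, and let $S^s$ ($S^a$) be the edges from $W\cap V^i$ (from $W\cap V^{1-i}$) to the complement of $W$. Restrict $G$ to $W$, and start with all other output sets empty. Repeat: if $G$ is empty, stop; let $d$ be the highest occurring priority. * If $d$ is odd, let $W_{\neg d}=\mathrm{Parity}_{0,1}(G|_{V\setminus P^{-1}(d)},P)$,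 add $\mathrm{CoLive}(G,W_{\neg d},i)$ to $(D^s,D^a)$, and add $V\setminus W_{\neg d}$ to $\mathcal C$. * If $d$ is even, let $W_d=\mathrm{B\ddot uchi}_{0,1}(G,P^{-1}(d))$ and $W_{\neg d}=V\setminus W_d$; for every odd $l\le d$ let $T_l$ be the set of vertices of $W_d$ of even priority greater than $l$, let $(H^s,H^a)=\mathrm{Live}(G|_{W_d},T_l,i)$, and add $(W_d\cap P^{-1}(l),H^s)$ to $\mathcal H^s$ and $(W_d\cap P^{-1}(l),H^a)$ to $\mathcal H^a$. * If $d=0$, stop; otherwise restrict $G$ to $W_{\neg d}$, change priority $d$ to $0$, and repeat. Return $W$, $\mathcal C$, the strategy template $\Pi=(S^s,D^s,\mathcal H^s)$ and the assumption template $\Psi=(S^a,D^a,\mathcal H^a)$. (The loop over $l$ needs to be carried out only for those odd $l$ for which $l$ or $l+1$ occurs as a priority; the other $l$ yield no new live-groups and an empty condition set.) **$\mathrm{CheckTemplate}(G,(S,D,\mathcal H))$** returns true iff every vertex has an outgoing edge outside $D\cup S$ and, for every live-group $H$ occurring in $\mathcal H$, every source vertex of $H$ has an outgoing edge in $H\setminus(D\cup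 S)$. **$\mathrm{Negotiate}(G,P_0,P_1)$.** Let $d_i=\max P_i$ for the input priorities (and $d_i=0$ if $V=\emptyset$). Compute $(W_i,C_i,\Pi_i,\Psi_i)=\mathrm{ParityTemp}(G,P_i,i)$ for $i=0,1$. If $\mathrm{CheckTemplate}(G,\Psi_{1-i}\wedge\Pi_i)$ holds for both $i$, return $G,P_0,P_1$ and the templates. Otherwise repeat with $G$ restricted to $W_0\cap W_1$ and with all vertices of $C_0\cup C_1$ given priority $2d_i+1$ in $P_i$. **Cost model.** Running time is the number of elementary steps, where reading an adjacency entry, an owner or a priority, reading or writing one entry of a bit array representing a vertex or edge set, adding one item to a list, and comparing or computing with booleans, vertices or priorities have unit cost, and every operation on a whole set or list is a loop over its entries. Cooperative winning regions are computed by graph search: for $\mathrm{Parity}_{0,1}$, backward search from the vertices $u$ of even priority that lie on a cycle of vertices of priority at most that of $u$; for $\mathrm{B\ddot uchi}_{0,1}$, backward search from the target vertices on a cycle; for $\mathrm{Safety}_{0,1}$, the greatest fixed point iteration. **Theorem.** For every two-objective parity game, $\mathrm{Negotiate}$ terminates, and it does so in time $O(n^6)$: there is a constant $K$ such that for every two-objective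 parity game with $n\ge 1$ vertices and arbitrary priority functions, $\mathrm{Negotiate}$ halts after at most $K n^6$ elementary steps (and it also halts for $n=0$). -/

import Mathlib

namespace Negotiation

/-! ## Cost model

A computation of type `Comp α` either diverges or yields a value together with the number of
elementary steps executed.  Procedures are written in the monad `Comp`.  Apart from sequencing,
loops and control flow, they only use single steps `step a`: reading an entry of the adjacency
matrix, the owner or the priority of a vertex, one bit of a vertex or edge set (sets are bit arrays),
writing one such entry, putting one item in front of a list, and comparing or combining
booleans, vertices or numbers (arithmetic on priorities has unit cost).  Everything that concerns
a whole set or a whole list is an explicit loop, each iteration of which is paid for. -/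

/-- Possibly diverging computations with a step count. -/
structure Comp (α : Type) : Type where
  run : Part (α × ℕ)

namespace Comp

/-- `c.RunsTo a t`: the computation `c` terminates with result `a` after exactly `t` steps. -/
def RunsTo {α : Type} (c : Comp α) (a : α) (t : ℕ) : Prop :=
  (a, t) ∈ c.run

/-- One elementary step, with result `a`. -/
def step {α : Type} (a : α) : Comp α := ⟨Part.some (a, 1)⟩

/-- Sequencing: costs add up. -/
def bind {α β : Type} (c : Comp α) (f : α → Comp β) : Comp β :=
  ⟨c.run.bind fun p => (f p.1).run.map fun q => (q.1, p.2 + q.2)⟩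

instance : Monad Comp where
  pure a := ⟨Part.some (a, 0)⟩
  bind := Comp.bind

/-- Run `body a s` for the successive elements `a` of a list, threading the state `s`;
one step of overhead per iteration and one for leaving the loop. -/
def forEach {α σ : Type} (l : List α) (s : σ) (body : α → σ → Comp σ) : Comp σ :=
  match l with
  | [] => step s
  | a :: l => do
    let s ← body a s
    let s ← step s
    forEach l s body

/-- Unbounded iteration, used for `while` loops and for tail recursion: `f s` is run, and
`Sum.inl b` means "return `b`", `Sum.inr s'` means "continue with `s'`".
Diverges if no iteration returns (or if some `f s` diverges). -/
noncomputable def iterate {σ β : Type} (f : σ → Comp (β ⊕ σ)) (s : σ) : Comp β :=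
  ⟨PFun.fix (fun p : σ × ℕ => (f p.1).run.map fun r =>
    match r with
    | (Sum.inl b, t) => (Sum.inl (b, p.2 + t) : (β × ℕ) ⊕ (σ × ℕ))
    | (Sum.inr s', t) => Sum.inr (s', p.2 + t)) (s, 0)⟩

end Comp

open _root_.Negotiation.Comp

/-! ## Games and templates -/

/-- A game graph: the vertex `v` belongs to player `owner v`, the adjacency matrix is `adj`, and
every vertex has a successor. -/
structure GameGraph (V : Type) where
  owner : V → Fin 2
  adj : V → V → Bool
  total : ∀ v, ∃ w, adj v w = true

/-- A live-group is a set of edges. -/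
abbrev LiveGroup (V : Type) : Type := Finset (V × V)

/-- A template `(S, D, H)`: unsafe edges, co-live edges and conditional live-groups `(R, Hℓ)`. -/
structure Template (V : Type) where
  S : Finset (V × V)
  D : Finset (V × V)
  H : List (Finset V × List (LiveGroup V))

section Procedures

variable {V : Type} [Fintype V] [DecidableEq V]

/-! ## Elementary set operations -/

variable (V) in
/-- The list of all vertices. -/
noncomputable def vertices : List V := Finset.univ.toList

/-- Read one bit of a set of vertices or of edges. -/
def mem {α : Type} [DecidableEq α] (a : α) (U : Finset α) : Comp Bool := step (decide (a ∈ U))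

/-- Read one entry of the adjacency matrix. -/
def edge (G : GameGraph V) (u v : V) : Comp Bool := step (G.adj u v)

/-- Does `v` belong to player `a`? -/
def owned (G : GameGraph V) (a : Fin 2) (v : V) : Comp Bool := step (decide (G.owner v = a))

/-- The set of vertices that pass the test `p`. -/
noncomputable def filterV (p : V → Comp Bool) : Comp (Finset V) :=
  forEach (vertices V) ∅ fun v U => do
    if ← p v then step (insert v U) else step U

/-- The set of pairs of vertices that pass the test `p`. -/
noncomputable def filterE (p : V → V → Comp Bool) : Comp (Finset (V × V)) :=
  forEach (vertices V) ∅ fun u R =>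
    forEach (vertices V) R fun v R => do
      if ← p u v then step (insert (u, v) R) else step R

/-- Does some element of the list pass the test `p`? -/
def anyIn {α : Type} (l : List α) (p : α → Comp Bool) : Comp Bool :=
  forEach l false fun a b => do
    let c ← p a
    step (b || c)

/-- Do all elements of the list pass the test `p`? -/
def allIn {α : Type} (l : List α) (p : α → Comp Bool) : Comp Bool :=
  forEach l true fun a b => do
    let c ← p a
    step (b && c)

/-- The union of two lists, regarded as sets. -/
def append {α : Type} (l l' : List α) : Comp (List α) :=
  forEach l l' fun a acc => step (a :: acc)

noncomputable def unionV (U W : Finset V) : Comp (Finset V) :=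
  filterV fun v => do return (← mem v U) || (← mem v W)

noncomputable def interV (U W : Finset V) : Comp (Finset V) :=
  filterV fun v => do return (← mem v U) && (← mem v W)

noncomputable def diffV (U W : Finset V) : Comp (Finset V) :=
  filterV fun v => do return (← mem v U) && !(← mem v W)

noncomputable def eqV (U W : Finset V) : Comp Bool :=
  allIn (vertices V) fun v => do return (← mem v U) == (← mem v W)

noncomputable def unionE (D D' : Finset (V × V)) : Comp (Finset (V × V)) :=
  filterE fun u v => do return (← mem (u, v) D) || (← mem (u, v) D')

/-- `E ∩ (A × B)`. -/
noncomputable def edgesBetween (G : GameGraph V) (A B : Finset V) : Comp (Finset (V × V)) :=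
  filterE fun u v => do return (← mem u A) && (← mem v B) && (← edge G u v)

/-- The edges in `D` whose source belongs to player `a`. -/
noncomputable def edgesFrom (G : GameGraph V) (a : Fin 2) (D : Finset (V × V)) :
    Comp (Finset (V × V)) :=
  filterE fun u v => do return (← mem (u, v) D) && (← owned G a u)

/-! ## Set transformers

All procedures below work on the restriction `G|_X` of a game graph to a set `X` of vertices; the
restriction may have dead ends. -/

/-- The vertices of `X` that have a successor in `U`. -/
noncomputable def pre (G : GameGraph V) (X U : Finset V) : Comp (Finset V) :=
  filterV fun v => do
    let x ← mem v X
    let e ← anyIn (vertices V) fun w => do return (← mem w U) && (← edge G v w)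
    return x && e

/-- Controllable predecessor of player `a` in `G|_X`: the vertices of player `a` with some successor
in `U`, and the vertices of the other player all of whose successors are in `U`. -/
noncomputable def cpre (G : GameGraph V) (X : Finset V) (a : Fin 2) (U : Finset V) :
    Comp (Finset V) :=
  filterV fun v => do
    let x ← mem v X
    if ← owned G a v then
      let e ← anyIn (vertices V) fun w => do
        return (← mem w X) && (← edge G v w) && (← mem w U)
      return x && e
    else
      let e ← allIn (vertices V) fun w => do
        return !((← mem w X) && (← edge G v w)) || (← mem w U)
      return x && e

/-- The procedure `Attr_a (G|_X, U)`.  The loop variable `A` runs through `cpre^{a,k}(U)`,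
`k = 0, 1, …`, with `cpre^{a,0}(U) = U`, until it is stable.  The result is the attractor without `U`,
and for each `k > 0` the live-group of the edges of player `a` from `cpre^{a,k}(U)` to
`cpre^{a,k-1}(U)`. -/
noncomputable def attr (G : GameGraph V) (X : Finset V) (a : Fin 2) (U : Finset V) :
    Comp (Finset V × List (LiveGroup V)) :=
  iterate (fun s : Finset V × List (LiveGroup V) => do
      let A := s.1
      let C ← cpre G X a A
      let A' ← unionV C A
      let H ← edgesFrom G a (← edgesBetween G A' A)
      let Hs ← step (H :: s.2)
      if ← eqV A' A then
        return Sum.inl (← diffV A U, Hs)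
      else
        return Sum.inr (A', Hs))
    (U, [])

/-! ## Cooperative winning regions -/

/-- The vertices of `X` from which `T ⊆ X` is reachable (in zero or more steps) inside `X`: backward
graph search with a set of visited vertices and a work list. -/
noncomputable def backReach (G : GameGraph V) (X T : Finset V) : Comp (Finset V) := do
  let L ← forEach (vertices V) [] fun v L => do
    if ← mem v T then step (v :: L) else step L
  iterate (fun s : Finset V × List V =>
      match s.2 with
      | [] => do return Sum.inl (← step s.1)
      | u :: L => do
        let s' ← forEach (vertices V) (s.1, L) fun v q => do
          let new := (← mem v X) && !(← mem v q.1) && (← edge G v u)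
          if new then step (insert v q.1, v :: q.2) else step q
        return Sum.inr s')
    (T, L)

/-- Does `u ∈ X` lie on a (nonempty) cycle inside `X`? -/
noncomputable def onCycle (G : GameGraph V) (X : Finset V) (u : V) : Comp Bool := do
  let T ← filterV fun v => step (decide (v = u))
  let R ← backReach G X T
  anyIn (vertices V) fun w => do return (← edge G u w) && (← mem w R)

/-- `Safety_{0,1}`: the greatest `Y ⊆ X ∩ I` each of whose vertices has a successor in `Y`. -/
noncomputable def coopSafety (G : GameGraph V) (X I : Finset V) : Comp (Finset V) := do
  let Y ← interV X I
  iterate (fun Y : Finset V => do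
      let Y' ← pre G Y Y
      if ← eqV Y' Y then return Sum.inl Y else return Sum.inr Y') Y

/-- `Büchi_{0,1}`: the vertices from which some infinite path of `G|_X` visits `I` infinitely often,
that is, from which a vertex of `I` on a cycle is reachable. -/
noncomputable def coopBuchi (G : GameGraph V) (X I : Finset V) : Comp (Finset V) := do
  let good ← filterV fun u => do
    if (← mem u X) && (← mem u I) then onCycle G X u else return false
  backReach G X good

/-- `Parity_{0,1}`: the vertices from which some infinite path of `G|_X` has an even highest priority
among those that occur infinitely often, that is, from which one can reach a vertex `u` of even
priority on a cycle whose priorities are at most that of `u`. -/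
noncomputable def coopParity (G : GameGraph V) (X : Finset V) (P : V → ℕ) : Comp (Finset V) := do
  let good ← filterV fun u => do
    if (← mem u X) && (← step (decide (Even (P u)))) then
      let Y ← filterV fun w => do return (← mem w X) && (← step (decide (P w ≤ P u)))
      onCycle G Y u
    else return false
  backReach G X good

/-! ## Computation of templates -/

/-- The procedure `Unsafe (G|_X, U, i)`: the edges leaving the cooperative winning region of the
safety objective `□ U`, from vertices of player `i` and of player `1 - i`. -/
noncomputable def unsafeEdges (G : GameGraph V) (X U : Finset V) (i : Fin 2) :
    Comp (Finset (V × V) × Finset (V × V)) := do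
  let Z ← coopSafety G X U
  let S ← edgesBetween G Z (← diffV X Z)
  return (← edgesFrom G i S, ← edgesFrom G (1 - i) S)

/-- The procedure `Live (G|_X, I, i)`; returns the live-groups for the strategy template and for the
assumption template. -/
noncomputable def live (G : GameGraph V) (X I : Finset V) (i : Fin 2) :
    Comp (List (LiveGroup V) × List (LiveGroup V)) := do
  let U ← interV I X
  iterate (fun s : Finset V × List (LiveGroup V) × List (LiveGroup V) => do
      let (U, Hs, Ha) := s
      if ← eqV U X then return Sum.inl (Hs, Ha)
      else
        let (W, H) ← attr G X i U
        let Hs ← append H Hs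
        let U ← unionV U W
        let C ← cpre G X (1 - i) U
        let H' ← edgesFrom G (1 - i) (← edgesBetween G C U)
        let Ha ← step (H' :: Ha)
        let U ← unionV U C
        return Sum.inr (U, Hs, Ha))
    (U, [], [])

/-- The procedure `CoLive (G|_X, I, i)`; returns the co-live edges of player `i` and of player
`1 - i`.  In each round, `N` is the layer of vertices that are newly found to have an edge into `U`;
edges inside this layer and edges leaving the enlarged set `U` become co-live. -/
noncomputable def coLive (G : GameGraph V) (X I : Finset V) (i : Fin 2) :
    Comp (Finset (V × V) × Finset (V × V)) := do
  let U ← coopSafety G X I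
  let D ← edgesBetween G U (← diffV X U)
  let D ← iterate (fun s : Finset V × Finset (V × V) => do
      let (U, D) := s
      if ← eqV U X then return Sum.inl D
      else
        let N ← diffV (← pre G X U) U
        let D ← unionE D (← edgesBetween G N N)
        let U ← unionV U N
        let D ← unionE D (← edgesBetween G U (← diffV X U))
        return Sum.inr (U, D))
    (U, D)
  return (← edgesFrom G i D, ← edgesFrom G (1 - i) D)

/-- The variables of the procedure `ComputeSets`: the current graph `G|_X` and priorities `P`, the
vertices `C` to be seen only finitely often, and the co-live edges and conditional live-groups for
the strategy template (`s`) and for the assumption template (`a`). -/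
structure SetsState (V : Type) where
  X : Finset V
  P : V → ℕ
  C : Finset V
  Ds : Finset (V × V)
  Da : Finset (V × V)
  Hs : List (Finset V × List (LiveGroup V))
  Ha : List (Finset V × List (LiveGroup V))

/-- The highest priority of a vertex of `X` (`0` if `X` is empty). -/
noncomputable def maxPriority (X : Finset V) (P : V → ℕ) : Comp ℕ :=
  forEach (vertices V) 0 fun v d => do
    if ← mem v X then step (max d (P v)) else step d

/-- Give all vertices of `C` priority `k`. -/
noncomputable def setPriority (C : Finset V) (k : ℕ) (P : V → ℕ) : Comp (V → ℕ) :=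
  forEach (vertices V) P fun v Q => do
    if ← mem v C then step (Function.update Q v k) else step Q

/-- One call of `ComputeSets` up to its recursive call, for highest priority `d` odd; also returns
the set `W_{¬d}`. -/
noncomputable def oddCase (G : GameGraph V) (i : Fin 2) (d : ℕ) (s : SetsState V) :
    Comp (Finset V × SetsState V) := do
  let Y ← filterV fun v => do return (← mem v s.X) && !(← step (decide (s.P v = d)))
  let Wn ← coopParity G Y s.P
  let (ds, da) ← coLive G s.X Wn i
  let Ds ← unionE s.Ds ds
  let Da ← unionE s.Da da
  let C ← unionV s.C (← diffV s.X Wn)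
  return (Wn, { s with C := C, Ds := Ds, Da := Da })

/-- One call of `ComputeSets` up to its recursive call, for highest priority `d` even; also returns
the set `W_{¬d}`.

The loop over all odd `l ≤ d` is carried out for those `l` such that `l` or `l + 1` is the priority
of some vertex `v` of the current graph.  No other odd `l ≤ d` contributes anything: no vertex has
priority `l`, and the set of vertices of even priority above `l`, hence also the live-groups, are
those of `l' ≥ l`, where `l' + 1` is the least even priority above `l` that occurs. -/
noncomputable def evenCase (G : GameGraph V) (i : Fin 2) (d : ℕ) (s : SetsState V) :
    Comp (Finset V × SetsState V) := do
  let I ← filterV fun v => do return (← mem v s.X) && (← step (decide (s.P v = d)))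
  let Wd ← coopBuchi G s.X I
  let Wn ← diffV s.X Wd
  let s' ← forEach (vertices V) s fun v r => do
    if (← mem v s.X) && (← step (decide (s.P v ≠ 0))) then
      let l ← step (if Odd (s.P v) then s.P v else s.P v - 1)
      let T ← filterV fun w => do
        return (← mem w Wd) && (← step (decide (Even (s.P w)))) && (← step (decide (l < s.P w)))
      let (hs, ha) ← live G Wd T i
      let R ← filterV fun w => do return (← mem w Wd) && (← step (decide (s.P w = l)))
      step { r with Hs := (R, hs) :: r.Hs, Ha := (R, ha) :: r.Ha }
    else step r
  return (Wn, s')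

/-- The procedure `ComputeSets`.  The recursive call is a tail call. -/
noncomputable def computeSets (G : GameGraph V) (i : Fin 2) : SetsState V → Comp (SetsState V) :=
  iterate fun s => do
    if ← eqV s.X ∅ then return Sum.inl s
    else
      let d ← maxPriority s.X s.P
      let (Wn, s') ← if Odd d then oddCase G i d s else evenCase G i d s
      if ← step (decide (0 < d)) then
        let Pd ← filterV fun v => step (decide (s.P v = d))
        let P ← setPriority Pd 0 s.P
        return Sum.inr { s' with X := Wn, P := P }
      else return Sum.inl s'

/-- The result of `ParityTemp` for player `i`: the winning region `W`, the set `C`, the strategy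
template `strat` and the assumption template `assum`. -/
structure ParityTempResult (V : Type) where
  W : Finset V
  C : Finset V
  strat : Template V
  assum : Template V

/-- The algorithm `ParityTemp (G|_X, P, i)`. -/
noncomputable def parityTemp (G : GameGraph V) (X : Finset V) (P : V → ℕ) (i : Fin 2) :
    Comp (ParityTempResult V) := do
  let Z ← coopParity G X P
  let (Ss, Sa) ← unsafeEdges G X Z i
  let r ← computeSets G i { X := Z, P := P, C := ∅, Ds := ∅, Da := ∅, Hs := [], Ha := [] }
  return { W := Z, C := r.C, strat := ⟨Ss, r.Ds, r.Hs⟩, assum := ⟨Sa, r.Da, r.Ha⟩ }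

/-! ## Negotiation -/

/-- The conjunction of two templates. -/
noncomputable def conj (Λ Λ' : Template V) : Comp (Template V) := do
  let S ← unionE Λ.S Λ'.S
  let D ← unionE Λ.D Λ'.D
  let H ← append Λ.H Λ'.H
  return ⟨S, D, H⟩

/-- The edge `(v, w)` is neither co-live nor unsafe. -/
def allowed (Λ : Template V) (v w : V) : Comp Bool := do
  return !(← mem (v, w) Λ.D) && !(← mem (v, w) Λ.S)

/-- The procedure `CheckTemplate (G|_X, Λ)`: (i) every vertex has an outgoing edge that is neither
co-live nor unsafe, and (ii) in every live-group, every source vertex has such an outgoing edge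
that belongs to the live-group. -/
noncomputable def checkTemplate (G : GameGraph V) (X : Finset V) (Λ : Template V) :
    Comp Bool := do
  let b₁ ← allIn (vertices V) fun v => do
    let x ← mem v X
    let e ← anyIn (vertices V) fun w => do
      return (← mem w X) && (← edge G v w) && (← allowed Λ v w)
    return !x || e
  let b₂ ← allIn Λ.H fun c => allIn c.2 fun H => allIn (vertices V) fun v => do
    let source ← anyIn (vertices V) fun w => mem (v, w) H
    let e ← anyIn (vertices V) fun w => do return (← mem (v, w) H) && (← allowed Λ v w)
    return !source || e
  return b₁ && b₂

/-- The result of `Negotiate`: the modified specifications, given as a restricted graph `G|_X` with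
priority functions `P₀`, `P₁`, and for each player `i` the templates `assumᵢ`, `stratᵢ`. -/
structure NegotiateResult (V : Type) where
  X : Finset V
  P₀ : V → ℕ
  P₁ : V → ℕ
  assum₀ : Template V
  strat₀ : Template V
  assum₁ : Template V
  strat₁ : Template V

/-- One negotiation round on `G|_X` with priority functions `P₀`, `P₁`: either return, or continue
with the strengthened specifications `Φᵢ ∧ □ (W₀ ∩ W₁) ∧ ◇□ ¬ (C₀ ∪ C₁)`, which are turned into
a parity game by restricting the graph to `W₀ ∩ W₁` and giving the vertices in `C₀ ∪ C₁` the odd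
priority `2 * dᵢ + 1`, where `dᵢ` is the highest priority of the input. -/
noncomputable def negotiationRound (G : GameGraph V) (d₀ d₁ : ℕ)
    (s : Finset V × (V → ℕ) × (V → ℕ)) :
    Comp (NegotiateResult V ⊕ (Finset V × (V → ℕ) × (V → ℕ))) := do
  let (X, P₀, P₁) := s
  let r₀ ← parityTemp G X P₀ 0
  let r₁ ← parityTemp G X P₁ 1
  let b₀ ← checkTemplate G X (← conj r₁.assum r₀.strat)
  let b₁ ← checkTemplate G X (← conj r₀.assum r₁.strat)
  if b₀ && b₁ then
    return Sum.inl ⟨X, P₀, P₁, r₀.assum, r₀.strat, r₁.assum, r₁.strat⟩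
  else
    let W ← interV r₀.W r₁.W
    let C ← unionV r₀.C r₁.C
    let P₀' ← setPriority C (2 * d₀ + 1) P₀
    let P₁' ← setPriority C (2 * d₁ + 1) P₁
    return Sum.inr (W, P₀', P₁')

/-- The algorithm `Negotiate` on the two-objective parity game with game graph `G` and objectives
`Parity P₀`, `Parity P₁`. -/
noncomputable def negotiate (G : GameGraph V) (P₀ P₁ : V → ℕ) : Comp (NegotiateResult V) := do
  let X ← filterV fun _ => step true
  let d₀ ← maxPriority X P₀
  let d₁ ← maxPriority X P₁
  iterate (negotiationRound G d₀ d₁) (X, P₀, P₁)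

end Procedures

end Negotiation

/-! Termination rests on a measure: the number of vertices still present plus the number of vertices
not yet marked with the priority `2 * d₀ + 1`. A round that continues can only remove vertices and
mark further ones, so it suffices to show that a round doing neither passes both checks. The measure
is at most `2n` initially, so there are `O(n)` rounds.

Suppose nothing is removed and nothing new is marked, and let `M` be the set of marked vertices.
Then there are no unsafe edges. If marked vertices are present, their odd priority is the highest
for both players, and the first `ComputeSets` step must keep exactly `U = X \ M`: anything lost
would be marked, and marked vertices have the highest priority. No later step can be an odd one,
since it would mark a vertex of `U`. So every co-live edge comes from the single call `CoLive(G,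
U)`, and every live-group lies inside `U`. The co-live edges never stay inside `U` and never lead to
a smaller distance from `U`, while every vertex has an edge that does one or the other
(`exists_approaches`). As `U` is the same for both players, no template obstructs another and the
checks succeed (`Template.Respects.check`, `exists_runsWithin_negotiationRound`). Without marked
vertices the same holds with `U = X` and no co-live edges.

A round costs `O(n^5)`. Each `ComputeSets` step eliminates a nonzero priority or is the last one, so
there are `O(n)` steps, the dearest of which makes `n` calls of `Live`. Amortization keeps `Live` at
`O(n^3)`: an attractor call is charged to the vertices it adds. A template has `O(n^3)` live-groups,
each checked in `O(n^2)`. The inner loops of `Live` and `CoLive` stop because the invariant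
`CoopWinning` makes their start set reachable from everywhere. -/

namespace Negotiation

open _root_.Negotiation.Comp

section

/-! ## Runs with a bound on the number of steps -/

/-- The computation `c` terminates with result `a` after at most `B` steps. -/
def Comp.RunsWithin {α : Type} (c : Comp α) (a : α) (B : ℕ) : Prop :=
  ∃ t ≤ B, c.RunsTo a t

namespace Comp

variable {α β σ : Type}

theorem RunsWithin.conv {c : Comp α} {a a' : α} {B B' : ℕ} (h : c.RunsWithin a B) (ha : a = a')
    (hB : B ≤ B') : c.RunsWithin a' B' := by
  obtain ⟨t, ht, hr⟩ := h
  exact ⟨t, ht.trans hB, ha ▸ hr⟩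

theorem RunsWithin.mono {c : Comp α} {a : α} {B B' : ℕ} (h : c.RunsWithin a B)
    (hB : B ≤ B') : c.RunsWithin a B' := h.conv rfl hB

theorem runsWithin_step (a : α) : (step a).RunsWithin a 1 :=
  ⟨1, le_rfl, Part.mem_some _⟩

theorem runsWithin_pure (a : α) : (pure a : Comp α).RunsWithin a 0 :=
  ⟨0, le_rfl, Part.mem_some _⟩

theorem RunsTo.bind {c : Comp α} {f : α → Comp β} {a : α} {b : β} {t t' : ℕ}
    (h : c.RunsTo a t) (h' : (f a).RunsTo b t') : (c >>= f).RunsTo b (t + t') := by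
  change (b, t + t') ∈ Part.bind _ _
  rw [Part.mem_bind_iff]
  refine ⟨(a, t), h, ?_⟩
  rw [Part.mem_map_iff]
  exact ⟨(b, t'), h', rfl⟩

theorem RunsWithin.bind {c : Comp α} {f : α → Comp β} {a : α} {b : β} {B B' : ℕ}
    (h : c.RunsWithin a B) (h' : (f a).RunsWithin b B') : (c >>= f).RunsWithin b (B + B') := by
  obtain ⟨t, ht, hr⟩ := h
  obtain ⟨t', ht', hr'⟩ := h'
  exact ⟨t + t', Nat.add_le_add ht ht', hr.bind hr'⟩

theorem RunsWithin.ite {p : Prop} [Decidable p] {c c' : Comp α} {a a' : α} {B : ℕ}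
    (h : p → c.RunsWithin a B) (h' : ¬p → c'.RunsWithin a' B) :
    (if p then c else c').RunsWithin (if p then a else a') B := by
  split_ifs with hp
  exacts [h hp, h' hp]

theorem RunsWithin.ite_pos {p : Prop} [Decidable p] {c c' : Comp α} {a : α} {B : ℕ} (hp : p)
    (h : c.RunsWithin a B) : (if p then c else c').RunsWithin a B := by
  rwa [if_pos hp]

theorem RunsWithin.ite_neg {p : Prop} [Decidable p] {c c' : Comp α} {a : α} {B : ℕ} (hp : ¬p)
    (h : c'.RunsWithin a B) : (if p then c else c').RunsWithin a B := by
  rwa [if_neg hp]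

/-! ### Loops over lists -/

/-- The cost of an iteration may depend on the list element; this is needed for nested lists of
live-groups of different lengths. -/
theorem runsWithin_forEach {body : α → σ → Comp σ} {g : α → σ → σ} {B : α → ℕ}
    (h : ∀ a s, (body a s).RunsWithin (g a s) (B a)) (l : List α) (s : σ) :
    (forEach l s body).RunsWithin (l.foldl (fun s a => g a s) s)
      ((l.map fun a => B a + 1).sum + 1) := by
  induction l generalizing s with
  | nil => exact runsWithin_step s
  | cons a l ih =>
    refine RunsWithin.conv ((h a s).bind <| (runsWithin_step _).bind <| ih (g a s)) rfl ?_
    simp only [List.map_cons, List.sum_cons]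
    omega

/-- The invariant also sees the elements still to come, so that statements of the form "already
handled or still in the list" can be carried through the loop. -/
theorem exists_runsWithin_forEach {body : α → σ → Comp σ} {I : List α → σ → Prop} {B : ℕ}
    (h : ∀ a l s, I (a :: l) s → ∃ s', (body a s).RunsWithin s' B ∧ I l s') (l : List α) (s : σ)
    (hs : I l s) :
    ∃ s', (forEach l s body).RunsWithin s' (l.length * (B + 1) + 1) ∧ I [] s' := by
  induction l generalizing s with
  | nil => exact ⟨s, (runsWithin_step s).mono (by simp), hs⟩
  | cons a l ih =>
    obtain ⟨s₁, h₁, hI₁⟩ := h a l s hs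
    obtain ⟨s₂, h₂, hI₂⟩ := ih s₁ hI₁
    refine ⟨s₂, RunsWithin.conv (h₁.bind <| (runsWithin_step _).bind <| h₂) rfl ?_, hI₂⟩
    simp only [List.length_cons]
    nlinarith

/-! ### Unbounded loops -/

/-- One iteration of a loop, with the steps executed so far as part of the state. -/
noncomputable def timedIteration (f : σ → Comp (β ⊕ σ)) : σ × ℕ →. (β × ℕ) ⊕ (σ × ℕ) :=
  fun p => (f p.1).run.map fun r =>
    match r with
    | (Sum.inl b, t) => Sum.inl (b, p.2 + t)
    | (Sum.inr s', t) => Sum.inr (s', p.2 + t)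

theorem runsTo_iterate_iff {f : σ → Comp (β ⊕ σ)} {s : σ} {b : β} {t : ℕ} :
    (iterate f s).RunsTo b t ↔ (b, t) ∈ (timedIteration f).fix (s, 0) := by
  -- The loop body inside `iterate` agrees with `timedIteration` pointwise; an arbitrary `g` stands
  -- for it until the two are compared case by case.
  have h : ∀ g : σ × ℕ →. (β × ℕ) ⊕ (σ × ℕ), (∀ p, g p = timedIteration f p) →
      ((b, t) ∈ g.fix (s, 0) ↔ (b, t) ∈ (timedIteration f).fix (s, 0)) := by
    intro g hg
    rw [show g = timedIteration f from funext hg]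
  refine h _ fun p => ?_
  unfold timedIteration
  congr 1
  funext r
  rcases r with ⟨_ | _, _⟩ <;> rfl

theorem inl_mem_timedIteration {f : σ → Comp (β ⊕ σ)} {p : σ × ℕ} {b : β} {t : ℕ} :
    Sum.inl (b, t) ∈ timedIteration f p ↔ ∃ u, (f p.1).RunsTo (Sum.inl b) u ∧ t = p.2 + u := by
  refine (Part.mem_map_iff _).trans ⟨?_, ?_⟩
  · rintro ⟨⟨r | r, u⟩, hr, hru⟩
    · simp only [Sum.inl.injEq, Prod.mk.injEq] at hru
      exact ⟨u, hru.1 ▸ hr, hru.2.symm⟩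
    · simp at hru
  · rintro ⟨u, hr, rfl⟩
    exact ⟨_, hr, rfl⟩

theorem inr_mem_timedIteration {f : σ → Comp (β ⊕ σ)} {p : σ × ℕ} {s : σ} {t : ℕ} :
    Sum.inr (s, t) ∈ timedIteration f p ↔ ∃ u, (f p.1).RunsTo (Sum.inr s) u ∧ t = p.2 + u := by
  refine (Part.mem_map_iff _).trans ⟨?_, ?_⟩
  · rintro ⟨⟨r | r, u⟩, hr, hru⟩
    · simp at hru
    · simp only [Sum.inr.injEq, Prod.mk.injEq] at hru
      exact ⟨u, hru.1 ▸ hr, hru.2.symm⟩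
  · rintro ⟨u, hr, rfl⟩
    exact ⟨_, hr, rfl⟩

/-- The counter is only ever added to, so a later start shifts the final count by the same amount.
This is what allows the first iteration of a loop to be split off. -/
theorem mem_fix_add {f : σ → Comp (β ⊕ σ)} {s : σ} {b : β} {t t₀ : ℕ}
    (h : (b, t) ∈ (timedIteration f).fix (s, t₀)) (t₁ : ℕ) :
    (b, t₁ + t) ∈ (timedIteration f).fix (s, t₁ + t₀) := by
  refine PFun.fixInduction (C := fun p => (b, t₁ + t) ∈ (timedIteration f).fix (p.1, t₁ + p.2)) h ?_
  rintro ⟨s, t₀⟩ hf ih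
  rw [PFun.mem_fix_iff] at hf ⊢
  rcases hf with hf | ⟨⟨s', t'⟩, hf, -⟩
  · left
    rw [inl_mem_timedIteration] at hf ⊢
    obtain ⟨u, hr, rfl⟩ := hf
    exact ⟨u, hr, (add_assoc _ _ _).symm⟩
  · right
    refine ⟨_, ?_, ih (s', t') hf⟩
    rw [inr_mem_timedIteration] at hf ⊢
    obtain ⟨u, hr, rfl⟩ := hf
    exact ⟨u, hr, (add_assoc _ _ _).symm⟩

theorem RunsWithin.iterate_inl {f : σ → Comp (β ⊕ σ)} {s : σ} {b : β} {B : ℕ}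
    (h : (f s).RunsWithin (Sum.inl b) B) : (iterate f s).RunsWithin b B := by
  obtain ⟨t, ht, hr⟩ := h
  refine ⟨t, ht, ?_⟩
  rw [runsTo_iterate_iff, PFun.mem_fix_iff, inl_mem_timedIteration]
  exact Or.inl ⟨t, hr, (zero_add t).symm⟩

theorem RunsWithin.iterate_inr {f : σ → Comp (β ⊕ σ)} {s s' : σ} {b : β} {B B' : ℕ}
    (h : (f s).RunsWithin (Sum.inr s') B) (h' : (iterate f s').RunsWithin b B') :
    (iterate f s).RunsWithin b (B + B') := by
  obtain ⟨t, ht, hr⟩ := h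
  obtain ⟨t', ht', hr'⟩ := h'
  refine ⟨t + t', Nat.add_le_add ht ht', ?_⟩
  rw [runsTo_iterate_iff] at hr' ⊢
  rw [PFun.mem_fix_iff]
  exact Or.inr ⟨(s', t + 0), inr_mem_timedIteration.2 ⟨t, hr, by simp⟩, mem_fix_add hr' t⟩

/-- A loop with invariant `I` terminates if each iteration is paid for, with one unit to spare, by
a decrease of the potential `μ`; what is left of the potential at the end is at least `φ`. -/
theorem exists_runsWithin_iterate {f : σ → Comp (β ⊕ σ)} {I : σ → Prop} {Q : β → Prop}
    {μ : σ → ℕ} {φ : β → ℕ}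
    (h : ∀ s, I s →
      (∃ b B, (f s).RunsWithin (Sum.inl b) B ∧ B + φ b ≤ μ s ∧ Q b) ∨
      ∃ s' B, (f s).RunsWithin (Sum.inr s') B ∧ B + 1 + μ s' ≤ μ s ∧ I s')
    (s : σ) (hs : I s) :
    ∃ b B, (iterate f s).RunsWithin b B ∧ B + φ b ≤ μ s ∧ Q b := by
  induction hm : μ s using Nat.strong_induction_on generalizing s with
  | _ m ih =>
    subst hm
    rcases h s hs with ⟨b, B, hr, hB, hQ⟩ | ⟨s', B, hr, hB, hI⟩
    · exact ⟨b, B, hr.iterate_inl, hB, hQ⟩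
    · obtain ⟨b, B', hr', hB', hQ⟩ := ih (μ s') (by omega) s' hI rfl
      exact ⟨b, B + B', hr.iterate_inr hr', by omega, hQ⟩

end Comp

/-! ## Elementary set operations -/

theorem runsWithin_edge {V : Type} (G : GameGraph V) (u v : V) :
    (edge G u v).RunsWithin (G.adj u v) 1 := runsWithin_step _

theorem runsWithin_owned {V : Type} (G : GameGraph V) (a : Fin 2) (v : V) :
    (owned G a v).RunsWithin (decide (G.owner v = a)) 1 := runsWithin_step _

theorem runsWithin_mem {α : Type} [DecidableEq α] (a : α) (U : Finset α) :
    (mem a U).RunsWithin (decide (a ∈ U)) 1 := runsWithin_step _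

/-- The number of vertices plus one. -/
def size (V : Type) [Fintype V] : ℕ := Fintype.card V + 1

theorem one_le_size (V : Type) [Fintype V] : 1 ≤ size V := Nat.le_add_left 1 _

theorem size_le_sq (V : Type) [Fintype V] : size V ≤ size V ^ 2 := by
  nlinarith [one_le_size V]

/-- Because of the added one this holds even for an empty vertex set, so terms of lower order can
always be absorbed. -/
theorem size_pow_le_pow (V : Type) [Fintype V] {k m : ℕ} (h : k ≤ m) :
    size V ^ k ≤ size V ^ m :=
  Nat.pow_le_pow_right (one_le_size V) h

section

variable {V : Type} [Fintype V]

theorem size_mul_size_mul_le (a b : ℕ) (h : a + 1 ≤ b) :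
    size V * (size V * a + 1) ≤ b * size V ^ 2 := by
  nlinarith [one_le_size V, Nat.mul_le_mul_right (size V ^ 2) h, size_le_sq V]

theorem length_vertices : (vertices V).length = Fintype.card V := by
  simp [vertices]

theorem mem_vertices (v : V) : v ∈ vertices V := by simp [vertices]

theorem length_vertices_mul_le (B : ℕ) :
    (vertices V).length * (B + 1) + 1 ≤ size V * (B + 1) := by
  rw [length_vertices, size]
  nlinarith

theorem runsWithin_forEach_vertices {σ : Type} {body : V → σ → Comp σ} {g : V → σ → σ} {B : ℕ}
    (h : ∀ a s, (body a s).RunsWithin (g a s) B) (s : σ) :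
    (forEach (vertices V) s body).RunsWithin ((vertices V).foldl (fun s a => g a s) s)
      (size V * (B + 1)) := by
  refine (runsWithin_forEach (B := fun _ => B) h (vertices V) s).mono ?_
  rw [List.map_const', List.sum_replicate, smul_eq_mul]
  exact length_vertices_mul_le B

theorem exists_runsWithin_forEach_vertices {σ : Type} {body : V → σ → Comp σ}
    {I : List V → σ → Prop} {B : ℕ}
    (h : ∀ a l s, I (a :: l) s → ∃ s', (body a s).RunsWithin s' B ∧ I l s') (s : σ)
    (hs : I (vertices V) s) :
    ∃ s', (forEach (vertices V) s body).RunsWithin s' (size V * (B + 1)) ∧ I [] s' := by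
  obtain ⟨s', hr, hI⟩ := exists_runsWithin_forEach h (vertices V) s hs
  exact ⟨s', hr.mono (length_vertices_mul_le B), hI⟩

theorem foldl_or {α : Type} (f : α → Bool) (l : List α) (b : Bool) :
    l.foldl (fun b a => b || f a) b = (b || l.any f) := by
  induction l generalizing b with
  | nil => simp
  | cons a l ih => simp [ih, Bool.or_assoc]

theorem foldl_and {α : Type} (f : α → Bool) (l : List α) (b : Bool) :
    l.foldl (fun b a => b && f a) b = (b && l.all f) := by
  induction l generalizing b with
  | nil => simp
  | cons a l ih => simp [ih, Bool.and_assoc]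

theorem runsWithin_allIn {α : Type} {p : α → Comp Bool} {f : α → Bool} {B : α → ℕ}
    (h : ∀ a, (p a).RunsWithin (f a) (B a)) (l : List α) :
    (allIn l p).RunsWithin (l.all f) ((l.map fun a => B a + 2).sum + 1) := by
  refine RunsWithin.conv (runsWithin_forEach (B := fun a => B a + 1)
    (fun a b => (h a).bind (runsWithin_step (b && f a))) l true) ?_ le_rfl
  simp [foldl_and]

theorem runsWithin_anyIn_vertices {p : V → Comp Bool} {f : V → Bool} {B : ℕ}
    (h : ∀ v, (p v).RunsWithin (f v) B) :
    (anyIn (vertices V) p).RunsWithin (decide (∃ v, f v = true)) (size V * (B + 2)) := by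
  refine RunsWithin.conv (runsWithin_forEach_vertices (B := B + 1)
    (fun a b => (h a).bind (runsWithin_step (b || f a))) false) ?_ le_rfl
  rw [foldl_or, Bool.eq_iff_iff]
  simp [mem_vertices]

theorem runsWithin_allIn_vertices {p : V → Comp Bool} {f : V → Bool} {B : ℕ}
    (h : ∀ v, (p v).RunsWithin (f v) B) :
    (allIn (vertices V) p).RunsWithin (decide (∀ v, f v = true)) (size V * (B + 2)) := by
  refine RunsWithin.conv (runsWithin_forEach_vertices (B := B + 1)
    (fun a b => (h a).bind (runsWithin_step (b && f a))) true) ?_ le_rfl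
  rw [foldl_and, Bool.eq_iff_iff]
  simp [mem_vertices]

theorem runsWithin_append {α : Type} (l l' : List α) :
    (append l l').RunsWithin (l.reverse ++ l') (2 * l.length + 1) := by
  refine RunsWithin.conv (runsWithin_forEach (B := fun _ => 1)
    (fun a acc => runsWithin_step (a :: acc)) l l') ?_ ?_
  · induction l generalizing l' with
    | nil => rfl
    | cons a l ih => simp [ih]
  · simp; omega

variable [DecidableEq V]

theorem runsWithin_filterV {p : V → Comp Bool} {f : V → Bool} {B : ℕ}
    (h : ∀ v, (p v).RunsWithin (f v) B) :
    (filterV p).RunsWithin (Finset.univ.filter fun v => f v = true) (size V * (B + 2)) := by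
  refine RunsWithin.conv (runsWithin_forEach_vertices (B := B + 1)
    (fun v U => (h v).bind (RunsWithin.ite (fun _ => runsWithin_step (insert v U))
      fun _ => runsWithin_step U)) ∅) ?_ le_rfl
  have key : ∀ (l : List V) (U : Finset V),
      l.foldl (fun U v => if f v = true then insert v U else U) U
        = U ∪ l.toFinset.filter fun v => f v = true := by
    intro l
    induction l with
    | nil => simp
    | cons a l ih =>
      intro U
      ext x
      rw [List.foldl_cons, ih]
      split_ifs with hf <;> simp <;> grind
  rw [key]
  ext x
  simp [mem_vertices]

theorem runsWithin_filterV_of_iff {p : V → Comp Bool} {f : V → Bool} {B : ℕ} {U : Finset V}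
    (h : ∀ v, (p v).RunsWithin (f v) B) (hU : ∀ v, f v = true ↔ v ∈ U) :
    (filterV p).RunsWithin U (size V * (B + 2)) :=
  (runsWithin_filterV h).conv (by ext v; simp [hU]) le_rfl

theorem runsWithin_filterE {p : V → V → Comp Bool} {f : V → V → Bool} {B : ℕ}
    (h : ∀ u v, (p u v).RunsWithin (f u v) B) :
    (filterE p).RunsWithin (Finset.univ.filter fun e : V × V => f e.1 e.2 = true)
      (size V * (size V * (B + 2) + 1)) := by
  refine RunsWithin.conv (runsWithin_forEach_vertices
    (fun u R => runsWithin_forEach_vertices (B := B + 1)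
    (fun v R => (h u v).bind (RunsWithin.ite (fun _ => runsWithin_step (insert (u, v) R))
      fun _ => runsWithin_step R)) R) ∅) ?_ le_rfl
  have key : ∀ (u : V) (l : List V) (R : Finset (V × V)) (e : V × V),
      e ∈ l.foldl (fun R v => if f u v = true then insert (u, v) R else R) R
        ↔ e ∈ R ∨ e.1 = u ∧ e.2 ∈ l ∧ f e.1 e.2 = true := by
    intro u l
    induction l with
    | nil => simp
    | cons a l ih =>
      rintro R ⟨x, y⟩
      rw [List.foldl_cons, ih]
      split_ifs with hf <;> simp <;> grind
  have key' : ∀ (l : List V) (R : Finset (V × V)) (e : V × V),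
      e ∈ l.foldl (fun R u => (vertices V).foldl
        (fun R v => if f u v = true then insert (u, v) R else R) R) R
        ↔ e ∈ R ∨ e.1 ∈ l ∧ f e.1 e.2 = true := by
    intro l
    induction l with
    | nil => simp
    | cons a l ih =>
      rintro R ⟨x, y⟩
      rw [List.foldl_cons, ih, key]
      simp [mem_vertices]
      grind
  ext e
  rw [key']
  simp [mem_vertices]

theorem runsWithin_unionV (U W : Finset V) : (unionV U W).RunsWithin (U ∪ W) (4 * size V) := by
  refine RunsWithin.conv (runsWithin_filterV fun v => (runsWithin_mem v U).bind <|
    (runsWithin_mem v W).bind <| runsWithin_pure _) ?_ (by linarith)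
  ext; simp

theorem runsWithin_interV (U W : Finset V) : (interV U W).RunsWithin (U ∩ W) (4 * size V) := by
  refine RunsWithin.conv (runsWithin_filterV fun v => (runsWithin_mem v U).bind <|
    (runsWithin_mem v W).bind <| runsWithin_pure _) ?_ (by linarith)
  ext; simp

theorem runsWithin_diffV (U W : Finset V) : (diffV U W).RunsWithin (U \ W) (4 * size V) := by
  refine RunsWithin.conv (runsWithin_filterV fun v => (runsWithin_mem v U).bind <|
    (runsWithin_mem v W).bind <| runsWithin_pure _) ?_ (by linarith)
  ext; simp

theorem runsWithin_eqV (U W : Finset V) :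
    (eqV U W).RunsWithin (decide (U = W)) (4 * size V) := by
  refine RunsWithin.conv (runsWithin_allIn_vertices fun v => (runsWithin_mem v U).bind <|
    (runsWithin_mem v W).bind <| runsWithin_pure _) ?_ (by linarith)
  rw [Bool.eq_iff_iff]
  simp [Finset.ext_iff]

theorem runsWithin_unionE (D D' : Finset (V × V)) :
    (unionE D D').RunsWithin (D ∪ D') (5 * size V ^ 2) := by
  refine RunsWithin.conv (runsWithin_filterE fun u v => (runsWithin_mem (u, v) D).bind <|
    (runsWithin_mem (u, v) D').bind <| runsWithin_pure _) ?_ (size_mul_size_mul_le _ _ (by simp))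
  ext; simp

theorem runsWithin_edgesBetween (G : GameGraph V) (A B : Finset V) :
    (edgesBetween G A B).RunsWithin
      (Finset.univ.filter fun e : V × V => e.1 ∈ A ∧ e.2 ∈ B ∧ G.adj e.1 e.2 = true)
      (6 * size V ^ 2) := by
  refine RunsWithin.conv (runsWithin_filterE fun u v => (runsWithin_mem u A).bind <|
    (runsWithin_mem v B).bind <| (runsWithin_edge G u v).bind <| runsWithin_pure _) ?_
    (size_mul_size_mul_le _ _ (by simp))
  ext; simp [and_assoc]

theorem runsWithin_edgesFrom (G : GameGraph V) (a : Fin 2) (D : Finset (V × V)) :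
    (edgesFrom G a D).RunsWithin (D.filter fun e => G.owner e.1 = a) (5 * size V ^ 2) := by
  refine RunsWithin.conv (runsWithin_filterE fun u v => (runsWithin_mem (u, v) D).bind <|
    (runsWithin_owned G a u).bind <| runsWithin_pure _) ?_ (size_mul_size_mul_le _ _ (by simp))
  ext; simp

theorem runsWithin_pre (G : GameGraph V) (X U : Finset V) :
    (pre G X U).RunsWithin
      (Finset.univ.filter fun v => v ∈ X ∧ ∃ w ∈ U, G.adj v w = true) (7 * size V ^ 2) := by
  refine RunsWithin.conv (runsWithin_filterV fun v => (runsWithin_mem v X).bind <|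
    RunsWithin.bind (runsWithin_anyIn_vertices fun w => (runsWithin_mem w U).bind <|
      (runsWithin_edge G v w).bind <| runsWithin_pure _) <| runsWithin_pure _) ?_ ?_
  · ext; simp
  · nlinarith [size_le_sq V]

/-- The controllable predecessor of player `a` in `G|_X`. -/
def cpreSet (G : GameGraph V) (X : Finset V) (a : Fin 2) (U : Finset V) : Finset V :=
  Finset.univ.filter fun v => v ∈ X ∧
    if G.owner v = a then ∃ w ∈ X, G.adj v w = true ∧ w ∈ U
    else ∀ w ∈ X, G.adj v w = true → w ∈ U

theorem runsWithin_cpre (G : GameGraph V) (X : Finset V) (a : Fin 2) (U : Finset V) :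
    (cpre G X a U).RunsWithin (cpreSet G X a U) (9 * size V ^ 2) := by
  have any (v : V) := runsWithin_anyIn_vertices (p := fun w => do
      return (← mem w X) && (← edge G v w) && (← mem w U)) fun w => (runsWithin_mem w X).bind <|
    (runsWithin_edge G v w).bind <| (runsWithin_mem w U).bind <| runsWithin_pure _
  have all (v : V) := runsWithin_allIn_vertices (p := fun w => do
      return !((← mem w X) && (← edge G v w)) || (← mem w U)) fun w => (runsWithin_mem w X).bind <|
    (runsWithin_edge G v w).bind <| (runsWithin_mem w U).bind <| runsWithin_pure _
  refine RunsWithin.conv (runsWithin_filterV fun v => (runsWithin_mem v X).bind <|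
    (runsWithin_owned G a v).bind <| RunsWithin.ite
      (fun _ => (any v).bind <| runsWithin_pure _)
      (fun _ => (all v).bind <| runsWithin_pure _)) ?_ ?_
  · ext v
    simp only [cpreSet, Finset.mem_filter, Finset.mem_univ, true_and, decide_eq_true_eq]
    split_ifs <;> simp <;> grind
  · nlinarith [size_le_sq V]

theorem runsWithin_maxPriority (X : Finset V) (P : V → ℕ) :
    (maxPriority X P).RunsWithin (X.sup P) (3 * size V) := by
  refine RunsWithin.conv (runsWithin_forEach_vertices
    (fun v d => (runsWithin_mem v X).bind (RunsWithin.ite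
      (fun _ => runsWithin_step (max d (P v))) fun _ => runsWithin_step d)) 0) ?_ (by linarith)
  have key : ∀ (l : List V) (d : ℕ),
      l.foldl (fun d v => if decide (v ∈ X) = true then max d (P v) else d) d
        = d ⊔ (l.toFinset ∩ X).sup P := by
    intro l
    induction l with
    | nil => simp
    | cons a l ih =>
      intro d
      rw [List.foldl_cons, ih]
      split_ifs with h <;> simp at h
      · simp [Finset.insert_inter_of_mem h, sup_assoc]
      · simp [Finset.insert_inter_of_notMem h]
  rw [key]
  have : (vertices V).toFinset ∩ X = X := by ext; simp [mem_vertices]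
  simp [this]

theorem runsWithin_setPriority (C : Finset V) (k : ℕ) (P : V → ℕ) :
    (setPriority C k P).RunsWithin (fun v => if v ∈ C then k else P v) (3 * size V) := by
  refine RunsWithin.conv (runsWithin_forEach_vertices
    (fun v Q => (runsWithin_mem v C).bind (RunsWithin.ite
      (fun _ => runsWithin_step (Function.update Q v k)) fun _ => runsWithin_step Q)) P) ?_
    (by linarith)
  have key : ∀ (l : List V) (Q : V → ℕ) (v : V),
      l.foldl (fun Q v => if decide (v ∈ C) = true then Function.update Q v k else Q) Q v
        = if v ∈ C ∧ v ∈ l then k else Q v := by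
    intro l
    induction l with
    | nil => simp
    | cons a l ih =>
      intro Q v
      rw [List.foldl_cons, ih]
      by_cases hv : v = a <;> simp <;> grind
  ext v
  rw [key]
  simp [mem_vertices]

end

end

section

variable {V : Type}

/-! ## Cooperative winning regions -/

/-- There is a (possibly empty) path from `v` to `w` inside `X`. -/
def Reaches (G : GameGraph V) (X : Finset V) : V → V → Prop :=
  Relation.ReflTransGen fun v w => v ∈ X ∧ w ∈ X ∧ G.adj v w = true

theorem Reaches.mem_left {G : GameGraph V} {X : Finset V} {v w : V} (h : Reaches G X v w)
    (hw : w ∈ X) : v ∈ X := by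
  rcases Relation.ReflTransGen.cases_head h with rfl | ⟨c, hc, -⟩
  exacts [hw, hc.1]

/-- A path stays inside every subset that is closed under predecessors and contains its end. -/
theorem Reaches.restrict {G : GameGraph V} {X Y : Finset V} {v w : V} (h : Reaches G X v w)
    (hw : w ∈ Y) (hY : ∀ a ∈ X, ∀ b ∈ Y, G.adj a b = true → a ∈ Y) :
    v ∈ Y ∧ Reaches G Y v w := by
  induction h using Relation.ReflTransGen.head_induction_on with
  | refl => exact ⟨hw, .refl⟩
  | head hab _ ih =>
    have ha := hY _ hab.1 _ ih.1 hab.2.2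
    exact ⟨ha, .head ⟨ha, ih.1, hab.2.2⟩ ih.2⟩

/-- A path stays inside every subset that is closed under successors and contains its start. -/
theorem Reaches.restrict_of_start {G : GameGraph V} {X Y Z : Finset V} {v w : V}
    (h : Reaches G X v w) (hv : v ∈ Y) (hY : ∀ a ∈ Y, ∀ b ∈ X, G.adj a b = true → b ∈ Y)
    (hZ : ∀ a ∈ X, a ∈ Y → a ∈ Z) : w ∈ Y ∧ Reaches G Z v w := by
  induction h with
  | refl => exact ⟨hv, .refl⟩
  | tail _ hab ih =>
    have hb := hY _ ih.1 _ hab.2.1 hab.2.2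
    exact ⟨hb, .tail ih.2 ⟨hZ _ hab.1 ih.1, hZ _ hab.2.1 hb, hab.2.2⟩⟩

theorem Reaches.mono {G : GameGraph V} {X Y : Finset V} {v w : V} (h : Reaches G X v w)
    (hXY : X ⊆ Y) : Reaches G Y v w :=
  Relation.ReflTransGen.mono (fun _ _ hab => ⟨hXY hab.1, hXY hab.2.1, hab.2.2⟩) _ _ h

/-- The vertex `u ∈ X` lies on a cycle inside `X`. -/
def OnCycle (G : GameGraph V) (X : Finset V) (u : V) : Prop :=
  ∃ w, G.adj u w = true ∧ Reaches G X w u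

theorem OnCycle.mono {G : GameGraph V} {X Y : Finset V} {u : V} (h : OnCycle G X u)
    (hXY : X ⊆ Y) : OnCycle G Y u := by
  obtain ⟨w, hw, hr⟩ := h
  exact ⟨w, hw, hr.mono hXY⟩

/-- Every vertex of `X` has a path inside `X` that wins cooperatively. -/
def CoopWinning (G : GameGraph V) (X : Finset V) (P : V → ℕ) : Prop :=
  ∀ v ∈ X, ∃ u ∈ X, Even (P u) ∧ OnCycle G (X.filter fun w => P w ≤ P u) u ∧ Reaches G X v u

theorem exists_adj_of_reaches {G : GameGraph V} {X Y : Finset V} {v u : V} (hv : v ∈ X)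
    (hYX : Y ⊆ X) (hr : Reaches G X v u) (hc : OnCycle G Y u) : ∃ w ∈ X, G.adj v w = true := by
  rcases Relation.ReflTransGen.cases_head hr with rfl | ⟨c, hc, -⟩
  · obtain ⟨w, hw, hr'⟩ := hc
    exact ⟨w, (hr'.mono hYX).mem_left hv, hw⟩
  · exact ⟨c, hc.2.1, hc.2.2⟩

/-- A successor is found on the path to the cycle or, if that path is empty, on the cycle itself.
Hence a winning region has no dead ends, and the safety iteration started from it is stable at once.
-/
theorem CoopWinning.exists_adj {G : GameGraph V} {X : Finset V} {P : V → ℕ}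
    (h : CoopWinning G X P) {v : V} (hv : v ∈ X) : ∃ w ∈ X, G.adj v w = true := by
  obtain ⟨u, -, -, hc, hr⟩ := h v hv
  exact exists_adj_of_reaches hv (Finset.filter_subset _ _) hr hc

theorem CoopWinning.congr {G : GameGraph V} {X : Finset V} {P P' : V → ℕ}
    (h : CoopWinning G X P) (hP : ∀ v ∈ X, P v = P' v) : CoopWinning G X P' := by
  intro v hv
  obtain ⟨u, hu, he, hc, hr⟩ := h v hv
  refine ⟨u, hu, hP u hu ▸ he, hc.mono fun w hw => ?_, hr⟩
  obtain ⟨hwX, hwu⟩ := Finset.mem_filter.1 hw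
  exact Finset.mem_filter.2 ⟨hwX, by rwa [← hP u hu, ← hP w hwX]⟩

/-- Going backwards along the cycle from `u`, a set `Z` closed under predecessors is never left. -/
theorem OnCycle.restrict {G : GameGraph V} {X Y Z W : Finset V} {u : V} (hc : OnCycle G Y u)
    (hu : u ∈ Z) (hYX : Y ⊆ X) (hZ : ∀ a ∈ X, ∀ b ∈ Z, G.adj a b = true → a ∈ Z)
    (hW : ∀ a ∈ Y, a ∈ Z → a ∈ W) : OnCycle G W u := by
  obtain ⟨w, hw, hr⟩ := hc
  refine ⟨w, hw, ?_⟩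
  clear hw
  suffices w ∈ Z ∧ Reaches G W w u from this.2
  induction hr using Relation.ReflTransGen.head_induction_on with
  | refl => exact ⟨hu, .refl⟩
  | head hab _ ih =>
    have ha := hZ _ (hYX hab.1) _ ih.1 hab.2.2
    exact ⟨ha, .head ⟨hW _ hab.1 ha, hW _ hab.2.1 ih.1, hab.2.2⟩ ih.2⟩

variable [Fintype V]

open Classical in
/-- The vertices from which `T` is reachable inside `X`. -/
noncomputable def reachSet (G : GameGraph V) (X : Finset V) (T : Set V) : Finset V :=
  Finset.univ.filter fun v => ∃ u ∈ T, Reaches G X v u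

theorem mem_reachSet {G : GameGraph V} {X : Finset V} {T : Set V} {v : V} :
    v ∈ reachSet G X T ↔ ∃ u ∈ T, Reaches G X v u := by
  simp [reachSet]

theorem reachSet_subset {G : GameGraph V} {X : Finset V} {T : Set V} (hT : T ⊆ ↑X) :
    reachSet G X T ⊆ X := by
  intro v hv
  obtain ⟨u, hu, hr⟩ := mem_reachSet.1 hv
  exact hr.mem_left (hT hu)

theorem subset_reachSet (G : GameGraph V) (X : Finset V) (T : Set V) : T ⊆ ↑(reachSet G X T) :=
  fun v hv => mem_reachSet.2 ⟨v, hv, .refl⟩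

theorem mem_reachSet_of_adj {G : GameGraph V} {X : Finset V} {T : Set V} (hT : T ⊆ ↑X) {a b : V}
    (ha : a ∈ X) (hb : b ∈ reachSet G X T) (hab : G.adj a b = true) : a ∈ reachSet G X T := by
  obtain ⟨u, hu, hr⟩ := mem_reachSet.1 hb
  exact mem_reachSet.2 ⟨u, hu, .head ⟨ha, hr.mem_left (hT hu), hab⟩ hr⟩

/-- The vertices from which some infinite path of `G|_X` visits `I` infinitely often. -/
noncomputable def buchiSet (G : GameGraph V) (X I : Finset V) : Finset V :=
  reachSet G X {u | u ∈ X ∧ u ∈ I ∧ OnCycle G X u}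

/-- The vertices from which some infinite path of `G|_X` satisfies the parity objective. -/
noncomputable def paritySet (G : GameGraph V) (X : Finset V) (P : V → ℕ) : Finset V :=
  reachSet G X {u | u ∈ X ∧ Even (P u) ∧ OnCycle G (X.filter fun w => P w ≤ P u) u}

theorem buchiSet_subset (G : GameGraph V) (X I : Finset V) : buchiSet G X I ⊆ X :=
  reachSet_subset fun _ h => h.1

theorem paritySet_subset (G : GameGraph V) (X : Finset V) (P : V → ℕ) : paritySet G X P ⊆ X :=
  reachSet_subset fun _ h => h.1

theorem mem_paritySet {G : GameGraph V} {X : Finset V} {P : V → ℕ} {v : V} :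
    v ∈ paritySet G X P ↔ ∃ u ∈ X, Even (P u) ∧ OnCycle G (X.filter fun w => P w ≤ P u) u ∧
      Reaches G X v u := by
  simp only [paritySet, mem_reachSet, Set.mem_ofPred_eq, and_assoc]

theorem mem_buchiSet {G : GameGraph V} {X I : Finset V} {v : V} :
    v ∈ buchiSet G X I ↔ ∃ u ∈ X, u ∈ I ∧ OnCycle G X u ∧ Reaches G X v u := by
  simp only [buchiSet, mem_reachSet, Set.mem_ofPred_eq, and_assoc]

theorem adj_mem_paritySet {G : GameGraph V} {X : Finset V} {P : V → ℕ} {a : V} (ha : a ∈ X)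
    {b : V} (hb : b ∈ paritySet G X P) (hab : G.adj a b = true) : a ∈ paritySet G X P :=
  mem_reachSet_of_adj (fun _ h => h.1) ha hb hab

theorem adj_mem_buchiSet {G : GameGraph V} {X I : Finset V} {a : V} (ha : a ∈ X)
    {b : V} (hb : b ∈ buchiSet G X I) (hab : G.adj a b = true) : a ∈ buchiSet G X I :=
  mem_reachSet_of_adj (fun _ h => h.1) ha hb hab

/-- The region is closed under predecessors, so it contains the winning cycles and the paths leading
to them: restricting the game to it destroys no witness. -/
theorem coopWinning_paritySet (G : GameGraph V) (X : Finset V) (P : V → ℕ) :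
    CoopWinning G (paritySet G X P) P := by
  intro v hv
  obtain ⟨u, hu, he, hc, hr⟩ := mem_paritySet.1 hv
  have huZ : u ∈ paritySet G X P := mem_paritySet.2 ⟨u, hu, he, hc, .refl⟩
  refine ⟨u, huZ, he, ?_, (hr.restrict huZ fun a ha b hb hab => adj_mem_paritySet ha hb hab).2⟩
  refine hc.restrict huZ (Finset.filter_subset _ X)
    (fun a ha b hb hab => adj_mem_paritySet ha hb hab) fun a ha haZ => ?_
  exact Finset.mem_filter.2 ⟨haZ, (Finset.mem_filter.1 ha).2⟩

/-- If the highest priority `d` is odd, then from every vertex one can reach the cooperative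
winning region of the subgraph without priority `d`. -/
theorem CoopWinning.exists_reaches {G : GameGraph V} {X Y : Finset V} {P : V → ℕ}
    (h : CoopWinning G X P) {d : ℕ} (hd : Odd d) (hmax : ∀ v ∈ X, P v ≤ d)
    (hY : ∀ v, v ∈ Y ↔ v ∈ X ∧ P v ≠ d) {v : V} (hv : v ∈ X) :
    ∃ u ∈ paritySet G Y P, Reaches G X v u := by
  obtain ⟨u, hu, he, hc, hr⟩ := h v hv
  -- An even witness lies strictly below the odd maximum, and so does its entire cycle, which
  -- therefore survives the deletion of priority `d`.
  have hne : P u ≠ d := fun h => (Nat.not_even_iff_odd.2 hd) (h ▸ he)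
  refine ⟨u, mem_paritySet.2 ⟨u, (hY u).2 ⟨hu, hne⟩, he, hc.mono ?_, .refl⟩, hr⟩
  intro w hw
  obtain ⟨hwX, hwu⟩ := Finset.mem_filter.1 hw
  refine Finset.mem_filter.2 ⟨(hY w).2 ⟨hwX, fun h => ?_⟩, hwu⟩
  have := hmax u hu
  omega

/-- Removing the vertices from which priority `d` can be seen infinitely often, and giving priority
`0` to the other vertices of priority `d`, preserves cooperative winning. -/
theorem CoopWinning.sdiff_buchiSet {G : GameGraph V} {X I Y : Finset V} {P P' : V → ℕ}
    {d : ℕ} (h : CoopWinning G X P) (hI : ∀ v, v ∈ I ↔ v ∈ X ∧ P v = d)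
    (hY : ∀ v, v ∈ Y ↔ v ∈ X ∧ v ∉ buchiSet G X I)
    (hP : ∀ v, P' v = if P v = d then 0 else P v) : CoopWinning G Y P' := by
  intro v hv
  obtain ⟨hvX, hvW⟩ := (hY v).1 hv
  obtain ⟨u, hu, he, hc, hr⟩ := h v hvX
  -- The complement of a set closed under predecessors is closed under successors, so winning paths
  -- and cycles that start in `Y` stay there.
  have hYs : ∀ a ∈ Y, ∀ b ∈ X, G.adj a b = true → b ∈ Y := fun a ha b hb hab =>
    (hY b).2 ⟨hb, fun hbW => ((hY a).1 ha).2 (adj_mem_buchiSet ((hY a).1 ha).1 hbW hab)⟩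
  obtain ⟨huY, hrY⟩ := hr.restrict_of_start hv hYs fun _ _ h => h
  have hcX := hc.mono (Finset.filter_subset _ X)
  have hne : P u ≠ d := fun hud =>
    ((hY u).1 huY).2 (mem_buchiSet.2 ⟨u, hu, (hI u).2 ⟨hu, hud⟩, hcX, .refl⟩)
  have hPu : P' u = P u := by rw [hP, if_neg hne]
  refine ⟨u, huY, hPu ▸ he, ?_, hrY⟩
  obtain ⟨w, hw, hwr⟩ := hc
  rcases Relation.ReflTransGen.cases_head hwr with rfl | ⟨c, hc', -⟩
  · exact ⟨w, hw, .refl⟩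
  · have hwY : w ∈ Y := hYs u huY w (Finset.filter_subset _ _ hc'.1) hw
    refine ⟨w, hw, (hwr.restrict_of_start hwY
      (fun a ha b hb => hYs a ha b (Finset.filter_subset _ _ hb)) fun a ha haY => ?_).2⟩
    refine Finset.mem_filter.2 ⟨haY, ?_⟩
    -- Relabelling only lowers priorities and leaves that of `u` unchanged, so the cycle still
    -- respects the bound.
    have := (Finset.mem_filter.1 ha).2
    rw [hPu, hP]
    split_ifs <;> omega

/-- From every vertex of the cooperative Büchi region, a target vertex can be reached inside the
region. -/
theorem exists_reaches_buchiSet {G : GameGraph V} {X I : Finset V} {v : V}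
    (hv : v ∈ buchiSet G X I) :
    ∃ u ∈ buchiSet G X I, u ∈ I ∧ Reaches G (buchiSet G X I) v u := by
  obtain ⟨u, hu, hI, hc, hr⟩ := mem_buchiSet.1 hv
  have huW : u ∈ buchiSet G X I := mem_buchiSet.2 ⟨u, hu, hI, hc, .refl⟩
  exact ⟨u, huW, hI, (hr.restrict huW fun a ha b hb hab => adj_mem_buchiSet ha hb hab).2⟩

/-! ### Correctness and cost of the graph searches -/

section

variable [DecidableEq V]

theorem card_compl_insert_add {s : Finset V} {v : V} (h : v ∉ s) :
    (insert v s)ᶜ.card + 1 = sᶜ.card := by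
  rw [Finset.compl_insert, Finset.card_erase_of_mem (Finset.mem_compl.2 h)]
  have : 0 < sᶜ.card := Finset.card_pos.2 ⟨v, Finset.mem_compl.2 h⟩
  omega

/-- The last equation is the accounting: a vertex that enters the work list leaves the unvisited
set. Scanning predecessors thus preserves the sum of both sizes, and only the removal of `u` from
the list lowers it. -/
theorem exists_runsWithin_predecessors (G : GameGraph V) (X R : Finset V) (L : List V) (u : V) :
    ∃ q : Finset V × List V,
      (forEach (vertices V) (R, L) fun v q => do
        let new := (← mem v X) && !(← mem v q.1) && (← edge G v u)
        if new then step (insert v q.1, v :: q.2) else step q).RunsWithin q (5 * size V) ∧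
      R ⊆ q.1 ∧ (∀ x ∈ q.1, x ∈ R ∨ x ∈ X ∧ G.adj x u = true) ∧
      (∀ x ∈ X, G.adj x u = true → x ∈ q.1) ∧ (∀ x ∈ q.2, x ∈ q.1 ∨ x ∈ L) ∧
      (∀ x ∈ L, x ∈ q.2) ∧ (∀ x ∈ q.1, x ∈ R ∨ x ∈ q.2) ∧
      q.2.length + q.1ᶜ.card = L.length + Rᶜ.card := by
  obtain ⟨q, hr, h⟩ := exists_runsWithin_forEach_vertices (V := V) (σ := Finset V × List V)
    (B := 4) (I := fun rem q =>
      R ⊆ q.1 ∧ (∀ x ∈ q.1, x ∈ R ∨ x ∈ X ∧ G.adj x u = true) ∧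
      (∀ x ∈ X, G.adj x u = true → x ∈ q.1 ∨ x ∈ rem) ∧ (∀ x ∈ q.2, x ∈ q.1 ∨ x ∈ L) ∧
      (∀ x ∈ L, x ∈ q.2) ∧ (∀ x ∈ q.1, x ∈ R ∨ x ∈ q.2) ∧
      q.2.length + q.1ᶜ.card = L.length + Rᶜ.card)
    (body := fun v q => do
        let new := (← mem v X) && !(← mem v q.1) && (← edge G v u)
        if new then step (insert v q.1, v :: q.2) else step q)
    (fun v rem q ⟨h₁, h₂, h₃, h₄, h₅, h₆, h₇⟩ =>
      ⟨_, RunsWithin.mono ((runsWithin_mem v X).bind <| (runsWithin_mem v q.1).bind <|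
        (runsWithin_edge G v u).bind <| RunsWithin.ite (fun _ => runsWithin_step _)
          fun _ => runsWithin_step _) (by norm_num), by
        split_ifs with hc
        · simp only [Bool.and_eq_true, decide_eq_true_eq, Bool.not_eq_true',
            decide_eq_false_iff_not] at hc
          have := card_compl_insert_add hc.1.2
          refine ⟨?_, ?_, ?_, ?_, ?_, ?_, ?_⟩
          · exact h₁.trans (Finset.subset_insert _ _)
          all_goals simp only [Finset.mem_insert, List.mem_cons, List.length_cons] at *
          all_goals grind
        · simp only [Bool.and_eq_true, decide_eq_true_eq, Bool.not_eq_true',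
            decide_eq_false_iff_not, not_and, and_imp] at hc
          simp only [List.mem_cons] at h₃
          refine ⟨h₁, h₂, ?_, h₄, h₅, h₆, h₇⟩
          grind⟩)
    (R, L) ⟨subset_rfl, fun x hx => .inl hx, fun x _ _ => .inr (mem_vertices x),
      fun x hx => .inr hx, fun x hx => hx, fun x hx => .inl hx, rfl⟩
  refine ⟨q, hr.mono (by linarith), ?_⟩
  simpa using h

theorem exists_runsWithin_toList (T : Finset V) :
    ∃ L : List V, (forEach (vertices V) ([] : List V) fun v L => do
        if ← mem v T then step (v :: L) else step L).RunsWithin L (3 * size V) ∧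
      (∀ x, x ∈ L ↔ x ∈ T) ∧ L.length ≤ Fintype.card V := by
  obtain ⟨L, hr, h⟩ := exists_runsWithin_forEach_vertices (V := V) (σ := List V)
    (B := 2) (I := fun rem L => (∀ x ∈ L, x ∈ T) ∧ (∀ x ∈ T, x ∈ L ∨ x ∈ rem) ∧
      L.length + rem.length ≤ Fintype.card V)
    (body := fun v L => do if ← mem v T then step (v :: L) else step L)
    (fun v rem L ⟨h₁, h₂, h₃⟩ =>
      ⟨_, RunsWithin.mono ((runsWithin_mem v T).bind <| RunsWithin.ite
          (fun _ => runsWithin_step _) fun _ => runsWithin_step _) (by norm_num), by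
        simp only [List.mem_cons, List.length_cons, decide_eq_true_eq] at *
        split_ifs with hc
        · simp only [List.mem_cons, List.length_cons]
          grind
        · grind⟩)
    [] ⟨by simp, fun x _ => .inr (mem_vertices x), by simp [length_vertices]⟩
  refine ⟨L, hr.mono (by linarith), fun x => ⟨h.1 x, fun hx => ?_⟩, by simpa using h.2.2⟩
  simpa using h.2.1 x hx

/-- Invariant: all predecessors of a visited vertex that is off the work list are visited. Once the
list is empty, the visited set is closed under predecessors and so contains everything that reaches
`T`. The length of the list plus the number of unvisited vertices drops in each of the `O(n)`
iterations, each of cost `O(n)`. -/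
theorem runsWithin_backReach (G : GameGraph V) {X T : Finset V} (hT : T ⊆ X) :
    (backReach G X T).RunsWithin (reachSet G X T) (15 * size V ^ 2) := by
  obtain ⟨L, hL, hLT, hlen⟩ := exists_runsWithin_toList T
  have hT' : (T : Set V) ⊆ ↑X := Finset.coe_subset.2 hT
  obtain ⟨R, B, hR, hB, rfl⟩ := exists_runsWithin_iterate
    (f := fun s : Finset V × List V =>
      match s.2 with
      | [] => do return Sum.inl (← step s.1)
      | u :: L => do
        let s' ← forEach (vertices V) (s.1, L) fun v q => do
          let new := (← mem v X) && !(← mem v q.1) && (← edge G v u)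
          if new then step (insert v q.1, v :: q.2) else step q
        return Sum.inr s')
    (I := fun s => T ⊆ s.1 ∧ s.1 ⊆ reachSet G X T ∧ (∀ x ∈ s.2, x ∈ s.1) ∧
      ∀ x ∈ X, ∀ y ∈ s.1, y ∉ s.2 → G.adj x y = true → x ∈ s.1)
    (Q := fun R => R = reachSet G X T)
    (μ := fun s => (s.2.length + s.1ᶜ.card) * (5 * size V + 1) + 1) (φ := fun _ => 0)
    (by
      rintro ⟨R, L⟩ ⟨h₁, h₂, h₃, h₄⟩
      rcases L with - | ⟨u, L⟩
      · left
        refine ⟨_, _, (runsWithin_step R).bind (runsWithin_pure _), by simp, ?_⟩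
        refine subset_antisymm h₂ fun v hv => ?_
        obtain ⟨w, hw, hr⟩ := mem_reachSet.1 hv
        exact (hr.restrict (h₁ hw) fun a ha b hb => h₄ a ha b hb (by simp)).1
      · right
        obtain ⟨q, hq, g₁, g₂, g₃, g₄, g₅, g₆, g₇⟩ := exists_runsWithin_predecessors G X R L u
        refine ⟨_, _, hq.bind (runsWithin_pure _), ?_, ?_, ?_, ?_, ?_⟩
        · simp only [g₇, List.length_cons]
          nlinarith
        · exact h₁.trans g₁
        · intro x hx
          rcases g₂ x hx with hx | hx
          · exact h₂ hx
          · exact mem_reachSet_of_adj hT' hx.1 (h₂ (h₃ u (by simp))) hx.2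
        · intro x hx
          rcases g₄ x hx with hx | hx
          · exact hx
          · exact g₁ (h₃ x (List.mem_cons_of_mem _ hx))
        · intro x hx y hy hyq hxy
          by_cases hyu : y = u
          · exact g₃ x hx (hyu ▸ hxy)
          · refine g₁ (h₄ x hx y ((g₆ y hy).resolve_right hyq) ?_ hxy)
            simp only [List.mem_cons, not_or]
            exact ⟨hyu, fun h => hyq (g₅ y h)⟩)
    (T, L) ⟨subset_rfl, subset_reachSet G X T, fun x hx => (hLT x).1 hx,
      fun x _ y hy hyL => absurd ((hLT y).2 hy) hyL⟩
  refine RunsWithin.conv (hL.bind hR) rfl ?_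
  have h₁ : Tᶜ.card ≤ Fintype.card V := Finset.card_le_univ _
  have h₂ : L.length + Tᶜ.card + 2 ≤ 2 * size V := by unfold size; omega
  have h₃ := Nat.mul_le_mul_right (5 * size V + 1) h₂
  have h₄ := size_le_sq V
  simp only at hB
  nlinarith

open Classical in
theorem runsWithin_onCycle (G : GameGraph V) {X : Finset V} {u : V} (hu : u ∈ X) :
    (onCycle G X u).RunsWithin (decide (OnCycle G X u)) (22 * size V ^ 2) := by
  refine RunsWithin.conv ((runsWithin_filterV_of_iff (U := {u})
    (fun v => runsWithin_step (decide (v = u))) (by simp)).bind <|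
    RunsWithin.bind (runsWithin_backReach G (by simpa using hu)) <|
      runsWithin_anyIn_vertices fun w => (runsWithin_edge G u w).bind <|
        (runsWithin_mem w _).bind <| runsWithin_pure _) ?_ ?_
  · rw [Bool.eq_iff_iff, decide_eq_true_iff, decide_eq_true_iff]
    simp [OnCycle, mem_reachSet]
  · nlinarith [size_le_sq V]

theorem runsWithin_coopBuchi (G : GameGraph V) (X I : Finset V) :
    (coopBuchi G X I).RunsWithin (buchiSet G X I) (50 * size V ^ 3) := by
  classical
  refine RunsWithin.conv ((runsWithin_filterV (B := 2 + 22 * size V ^ 2)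
    (f := fun u => if u ∈ X ∧ u ∈ I then decide (OnCycle G X u) else false) fun u => ?_).bind <|
    runsWithin_backReach G fun u hu => ?_) ?_ ?_
  · refine RunsWithin.conv ((runsWithin_mem u X).bind <| (runsWithin_mem u I).bind <|
      RunsWithin.ite (B := 22 * size V ^ 2) (fun h => runsWithin_onCycle G ?_)
      fun _ => (runsWithin_pure _).mono (Nat.zero_le _)) ?_ (by omega)
    · simp at h
      exact h.1
    · simp
  · by_contra hX
    simp [hX] at hu
  · unfold buchiSet
    congr 1
    ext u
    simp
    tauto
  · have := size_le_sq V
    have := size_pow_le_pow V (show 2 ≤ 3 by norm_num)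
    have : 1 ≤ size V := one_le_size V
    nlinarith

theorem runsWithin_coopParity (G : GameGraph V) (X : Finset V) (P : V → ℕ) :
    (coopParity G X P).RunsWithin (paritySet G X P) (60 * size V ^ 3) := by
  classical
  refine RunsWithin.conv ((runsWithin_filterV (B := 2 + 26 * size V ^ 2)
    (f := fun u => if u ∈ X ∧ Even (P u) then
      decide (OnCycle G (X.filter fun w => P w ≤ P u) u) else false) fun u => ?_).bind <|
    runsWithin_backReach G fun u hu => ?_) ?_ ?_
  · refine RunsWithin.conv ((runsWithin_mem u X).bind <| (runsWithin_step _).bind <|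
      RunsWithin.ite (B := 26 * size V ^ 2)
      (a := decide (OnCycle G (X.filter fun w => P w ≤ P u) u)) (fun h => ?_)
      fun _ => (runsWithin_pure _).mono (Nat.zero_le _)) ?_ (by omega)
    · simp at h
      refine RunsWithin.mono ((runsWithin_filterV_of_iff (U := X.filter fun w => P w ≤ P u)
        (fun w => (runsWithin_mem w X).bind <|
          (runsWithin_step (decide (P w ≤ P u))).bind <|
          runsWithin_pure (decide (w ∈ X) && decide (P w ≤ P u))) (by simp)).bind <|
          runsWithin_onCycle G ?_) ?_
      · simpa using h.1
      · nlinarith [size_le_sq V]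
    · simp
  · by_contra hX
    simp [hX] at hu
  · unfold paritySet
    congr 1
    ext u
    simp
    tauto
  · have := size_le_sq V
    have := size_pow_le_pow V (show 2 ≤ 3 by norm_num)
    have : 1 ≤ size V := one_le_size V
    nlinarith

/-- `Safety_{0,1}` returns the safe set at once if each of its vertices has a successor in it. -/
theorem runsWithin_coopSafety (G : GameGraph V) {X I : Finset V} (hI : I ⊆ X)
    (h : ∀ v ∈ I, ∃ w ∈ I, G.adj v w = true) :
    (coopSafety G X I).RunsWithin I (20 * size V ^ 2) := by
  have hXI : X ∩ I = I := Finset.inter_eq_right.2 hI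
  have hpre : (Finset.univ.filter fun v => v ∈ I ∧ ∃ w ∈ I, G.adj v w = true) = I := by
    ext v
    simpa using h v
  have hr := runsWithin_interV X I
  rw [hXI] at hr
  have hp := runsWithin_pre G I I
  rw [hpre] at hp
  refine RunsWithin.conv (hr.bind <| RunsWithin.iterate_inl (b := I) <| hp.bind <|
    (runsWithin_eqV I I).bind <| by
      rw [decide_eq_true rfl, if_pos rfl]
      exact runsWithin_pure _) rfl ?_
  · nlinarith [size_le_sq V]

end

end

section

/-! ## Live-groups and co-live edges -/

theorem eq_one_sub_of_ne : ∀ {o i : Fin 2}, o ≠ i → o = 1 - i := by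
  decide

theorem card_sdiff_eq_add {V : Type} [DecidableEq V] {X U U' : Finset V} (h : U ⊆ U') (h' : U' ⊆ X) :
    (X \ U).card = (X \ U').card + (U' \ U).card := by
  rw [Finset.card_sdiff_of_subset (h.trans h'), Finset.card_sdiff_of_subset h',
    Finset.card_sdiff_of_subset h]
  have h₁ := Finset.card_le_card h
  have h₂ := Finset.card_le_card h'
  omega

/-- If `U` is reachable from all of `X`, then some edge enters `U` unless `U = X`. -/
theorem exists_adj_into {V : Type} [DecidableEq V] {G : GameGraph V} {X T U : Finset V} (hTU : T ⊆ U) (hUX : U ⊆ X)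
    (hreach : ∀ v ∈ X, ∃ u ∈ T, Reaches G X v u) (hne : U ≠ X) :
    ∃ a ∈ X, a ∉ U ∧ ∃ b ∈ U, G.adj a b = true := by
  by_contra hcon
  push Not at hcon
  refine hne (subset_antisymm hUX fun v hv => ?_)
  obtain ⟨u, hu, hr⟩ := hreach v hv
  refine (hr.restrict (hTU hu) fun a ha b hb hab => ?_).1
  by_contra haU
  exact hcon a ha haU b hb hab

variable {V : Type} [Fintype V] [DecidableEq V]

theorem edges_subset_product {G : GameGraph V} {a : Fin 2} {X A B : Finset V} (hA : A ⊆ X)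
    (hB : B ⊆ X) :
    ((Finset.univ.filter fun e : V × V => e.1 ∈ A ∧ e.2 ∈ B ∧ G.adj e.1 e.2 = true).filter
      fun e => G.owner e.1 = a) ⊆ X ×ˢ X := by
  intro e he
  simp only [Finset.mem_filter, Finset.mem_univ, true_and] at he
  exact Finset.mem_product.2 ⟨hA he.1.1, hB he.1.2.1⟩

theorem cpreSet_subset (G : GameGraph V) (X : Finset V) (a : Fin 2) (U : Finset V) :
    cpreSet G X a U ⊆ X := by
  intro v hv
  exact (Finset.mem_filter.1 hv).2.1

/-- Every iteration but the last adds a vertex, so the cost is proportional to the number of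
vertices gained plus one. This finer bound, rather than one in terms of `n` alone, keeps `live`
cubic. -/
theorem exists_runsWithin_attr (G : GameGraph V) {X U : Finset V} (hU : U ⊆ X) (a : Fin 2) :
    ∃ W Hs, (attr G X a U).RunsWithin (W, Hs) (34 * size V ^ 2 * (W.card + 1)) ∧ W ⊆ X \ U ∧
      cpreSet G X a (U ∪ W) ⊆ U ∪ W ∧ Hs.length ≤ W.card + 1 ∧ ∀ H ∈ Hs, H ⊆ X ×ˢ X := by
  obtain ⟨⟨W, Hs⟩, B, hr, hB, h₁, h₂, h₃, h₄⟩ := exists_runsWithin_iterate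
    (f := fun s : Finset V × List (LiveGroup V) => do
      let A := s.1
      let C ← cpre G X a A
      let A' ← unionV C A
      let H ← edgesFrom G a (← edgesBetween G A' A)
      let Hs ← step (H :: s.2)
      if ← eqV A' A then
        return Sum.inl (← diffV A U, Hs)
      else
        return Sum.inr (A', Hs))
    (I := fun s => U ⊆ s.1 ∧ s.1 ⊆ X ∧ s.2.length ≤ (s.1 \ U).card ∧ ∀ H ∈ s.2, H ⊆ X ×ˢ X)
    (Q := fun r => r.1 ⊆ X \ U ∧ cpreSet G X a (U ∪ r.1) ⊆ U ∪ r.1 ∧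
      r.2.length ≤ r.1.card + 1 ∧ ∀ H ∈ r.2, H ⊆ X ×ˢ X)
    (μ := fun s => 34 * size V ^ 2 * ((X \ s.1).card + 1))
    -- The potential of the final set is handed back, so that only the gained vertices and one last
    -- iteration are paid for.
    (φ := fun r => 34 * size V ^ 2 * (X \ (U ∪ r.1)).card)
    (by
      rintro ⟨A, Hs⟩ ⟨hUA, hAX, hlen, hH⟩
      simp only at hUA hAX hlen hH
      have hA'X : cpreSet G X a A ∪ A ⊆ X := Finset.union_subset (cpreSet_subset G X a A) hAX
      have hsq := size_le_sq V
      have hone := one_le_size V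
      have hgroups : ∀ H ∈ ((Finset.univ.filter fun e : V × V =>
          e.1 ∈ cpreSet G X a A ∪ A ∧ e.2 ∈ A ∧ G.adj e.1 e.2 = true).filter
          fun e => G.owner e.1 = a) :: Hs, H ⊆ X ×ˢ X := by
        intro H hHs
        rcases List.mem_cons.1 hHs with rfl | hHs
        exacts [edges_subset_product hA'X hAX, hH H hHs]
      by_cases heq : cpreSet G X a A ∪ A = A
      · left
        have hUW : U ∪ A \ U = A := Finset.union_sdiff_of_subset hUA
        refine ⟨_, _, (runsWithin_cpre G X a A).bind <| (runsWithin_unionV _ A).bind <|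
          (runsWithin_edgesBetween G _ A).bind <| (runsWithin_edgesFrom G a _).bind <|
          (runsWithin_step _).bind <| (runsWithin_eqV _ A).bind <| by
            rw [decide_eq_true heq, if_pos rfl]
            exact (runsWithin_diffV A U).bind <| runsWithin_pure _, ?_,
          Finset.sdiff_subset_sdiff hAX subset_rfl, ?_, ?_, hgroups⟩
        · simp only [hUW]
          nlinarith
        · simp only [hUW]
          exact Finset.union_eq_right.1 heq
        · simpa using hlen
      · right
        have hss : A ⊆ cpreSet G X a A ∪ A := Finset.subset_union_right
        have hpos : 0 < ((cpreSet G X a A ∪ A) \ A).card := by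
          rw [Finset.card_pos, Finset.sdiff_nonempty]
          exact fun h => heq (subset_antisymm h hss)
        refine ⟨_, _, (runsWithin_cpre G X a A).bind <| (runsWithin_unionV _ A).bind <|
          (runsWithin_edgesBetween G _ A).bind <| (runsWithin_edgesFrom G a _).bind <|
          (runsWithin_step _).bind <| (runsWithin_eqV _ A).bind <| by
            rw [decide_eq_false heq, if_neg (by simp)]
            exact runsWithin_pure _, ?_, hUA.trans hss, hA'X, ?_, hgroups⟩
        · simp only
          rw [card_sdiff_eq_add hss hA'X]
          nlinarith [Nat.mul_le_mul_left (34 * size V ^ 2) hpos]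
        · have h₁ := Finset.card_sdiff_of_subset (hUA.trans hss)
          have h₂ := Finset.card_sdiff_of_subset hUA
          have h₃ := Finset.card_sdiff_of_subset hss
          have h₄ := Finset.card_le_card hUA
          have h₅ := Finset.card_le_card hss
          simp only [List.length_cons]
          omega)
    (U, []) ⟨subset_rfl, hU, by simp, by simp⟩
  refine ⟨W, Hs, hr.mono ?_, h₁, h₂, h₃, h₄⟩
  have hWX : U ∪ W ⊆ X := Finset.union_subset hU (h₁.trans Finset.sdiff_subset)
  have hW : (U ∪ W) \ U = W := by
    rw [Finset.union_sdiff_left]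
    exact Finset.sdiff_eq_self_of_disjoint
      (Finset.disjoint_of_subset_left h₁ Finset.sdiff_disjoint)
  have hc := card_sdiff_eq_add Finset.subset_union_left hWX
  rw [hW] at hc
  simp only [hc] at hB
  nlinarith

/-- Reachability of `I` prevents the loop from stalling. While `U ≠ X`, some edge enters `U` from a
vertex `a` outside; either the attractor takes `a`, or `a` belongs to player `1 - i` because the
attractor is closed under `cpreSet`, and then the second half of the iteration takes it. -/
theorem exists_runsWithin_live (G : GameGraph V) {X I : Finset V} (i : Fin 2)
    (hreach : ∀ v ∈ X, ∃ u ∈ I, u ∈ X ∧ Reaches G X v u) :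
    ∃ Hs Ha, (live G X I i).RunsWithin (Hs, Ha) (115 * size V ^ 3) ∧
      Hs.length ≤ 2 * size V ∧ Ha.length ≤ 2 * size V ∧
      (∀ H ∈ Hs, H ⊆ X ×ˢ X) ∧ ∀ H ∈ Ha, H ⊆ X ×ˢ X := by
  have hsq := size_le_sq V
  have hone := one_le_size V
  have hcube := size_pow_le_pow V (show 2 ≤ 3 by norm_num)
  have hX : X.card ≤ size V := (Finset.card_le_univ X).trans (Nat.le_succ _)
  obtain ⟨⟨Hs, Ha⟩, B, hr, hB, h₁, h₂, h₃, h₄⟩ := exists_runsWithin_iterate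
    (f := fun s : Finset V × List (LiveGroup V) × List (LiveGroup V) => do
      let (U, Hs, Ha) := s
      if ← eqV U X then return Sum.inl (Hs, Ha)
      else
        let (W, H) ← attr G X i U
        let Hs ← append H Hs
        let U ← unionV U W
        let C ← cpre G X (1 - i) U
        let H' ← edgesFrom G (1 - i) (← edgesBetween G C U)
        let Ha ← step (H' :: Ha)
        let U ← unionV U C
        return Sum.inr (U, Hs, Ha))
    (I := fun s => I ∩ X ⊆ s.1 ∧ s.1 ⊆ X ∧ s.2.1.length + 2 * (X \ s.1).card ≤ 2 * X.card ∧
      s.2.2.length + (X \ s.1).card ≤ X.card ∧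
      (∀ H ∈ s.2.1, H ⊆ X ×ˢ X) ∧ ∀ H ∈ s.2.2, H ⊆ X ×ˢ X)
    (Q := fun r => r.1.length ≤ 2 * X.card ∧ r.2.length ≤ X.card ∧
      (∀ H ∈ r.1, H ⊆ X ×ˢ X) ∧ ∀ H ∈ r.2, H ⊆ X ×ˢ X)
    (μ := fun s => 107 * size V ^ 2 * (X \ s.1).card + 4 * size V)
    (φ := fun _ => 0)
    (by
      rintro ⟨U, Hs, Ha⟩ ⟨hIU, hUX, hls, hla, hHs, hHa⟩
      simp only at hIU hUX hls hla hHs hHa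
      by_cases heq : U = X
      · left
        refine ⟨_, _, (runsWithin_eqV U X).bind <| by
          rw [decide_eq_true heq, if_pos rfl]
          exact runsWithin_pure _, ?_, ?_, ?_, hHs, hHa⟩ <;> simp only <;> omega
      · right
        obtain ⟨W, H, hattr, hWX, hcpre, hlen, hH⟩ := exists_runsWithin_attr G hUX i
        set U₂ := U ∪ W with hU₂
        set C := cpreSet G X (1 - i) U₂ with hC
        have hU₂X : U₂ ⊆ X := Finset.union_subset hUX (hWX.trans Finset.sdiff_subset)
        have hCX : C ⊆ X := cpreSet_subset G X _ _
        have hU₃X : U₂ ∪ C ⊆ X := Finset.union_subset hU₂X hCX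
        have hUU₃ : U ⊆ U₂ ∪ C := Finset.subset_union_left.trans Finset.subset_union_left
        have hW : W ⊆ (U₂ ∪ C) \ U := fun w hw => Finset.mem_sdiff.2
          ⟨Finset.mem_union_left _ (Finset.mem_union_right _ hw),
            (Finset.mem_sdiff.1 (hWX hw)).2⟩
        have hWcard := Finset.card_le_card hW
        have hpos : 0 < ((U₂ ∪ C) \ U).card := by
          obtain ⟨a, haX, haU, b, hb, hab⟩ := exists_adj_into (T := I ∩ X) hIU hUX
            (fun v hv => by
              obtain ⟨u, hu, huX, hr⟩ := hreach v hv
              exact ⟨u, Finset.mem_inter.2 ⟨hu, huX⟩, hr⟩) heq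
          refine Finset.card_pos.2 ⟨a, Finset.mem_sdiff.2 ⟨?_, haU⟩⟩
          by_cases haU₂ : a ∈ U₂
          · exact Finset.mem_union_left _ haU₂
          refine Finset.mem_union_right _ ?_
          have hbU₂ : b ∈ U₂ := Finset.mem_union_left _ hb
          have hown : G.owner a ≠ i := fun ho => haU₂ <| hcpre <| by
            simp only [cpreSet, Finset.mem_filter, Finset.mem_univ, true_and, ho, if_true]
            exact ⟨haX, b, hU₂X hbU₂, hab, hbU₂⟩
          have hown' := eq_one_sub_of_ne hown
          simp only [hC, cpreSet, Finset.mem_filter, Finset.mem_univ, true_and, hown', if_true]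
          exact ⟨haX, b, hU₂X hbU₂, hab, hbU₂⟩
        have hcard := card_sdiff_eq_add hUU₃ hU₃X
        refine ⟨_, _, (runsWithin_eqV U X).bind <| by
          rw [decide_eq_false heq, if_neg (by simp)]
          exact hattr.bind <| (runsWithin_append H Hs).bind <| (runsWithin_unionV U W).bind <|
            (runsWithin_cpre G X (1 - i) U₂).bind <| (runsWithin_edgesBetween G C U₂).bind <|
            (runsWithin_edgesFrom G (1 - i) _).bind <| (runsWithin_step _).bind <|
            (runsWithin_unionV U₂ C).bind <| runsWithin_pure _, ?_, hIU.trans hUU₃, hU₃X,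
            ?_, ?_, ?_, ?_⟩
        · simp only
          rw [hcard]
          generalize ((U₂ ∪ C) \ U).card = g at *
          -- `W` is contained in the set of `g ≥ 1` new vertices, so both the cost of `attr` and its
          -- at most `W.card + 1` live-groups can be charged to `2 * g`. The factor 2 in the
          -- invariant on the length of `Hs` has the same origin.
          have hg : W.card + 1 ≤ 2 * g := by omega
          have h₁ := Nat.mul_le_mul_left (36 * size V ^ 2) hg
          have h₂ := Nat.mul_le_mul_left (35 * size V ^ 2) hpos
          nlinarith
        · simp only [List.length_append, List.length_reverse]
          omega
        · simp only [List.length_cons]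
          omega
        · intro K hK
          simp only [List.mem_append, List.mem_reverse] at hK
          rcases hK with hK | hK
          exacts [hH K hK, hHs K hK]
        · intro K hK
          simp only [List.mem_cons] at hK
          rcases hK with rfl | hK
          exacts [edges_subset_product hCX hU₂X, hHa K hK])
    (I ∩ X, [], []) ⟨subset_rfl, Finset.inter_subset_right, by
      have := Finset.card_le_card (Finset.sdiff_subset (s := X) (t := I ∩ X))
      simpa using this, by
      have := Finset.card_le_card (Finset.sdiff_subset (s := X) (t := I ∩ X))
      simpa using this, by simp, by simp⟩
  simp only at h₁ h₂
  refine ⟨Hs, Ha, ((runsWithin_interV I X).bind hr).mono ?_, by omega, by omega, h₃, h₄⟩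
  have hle : (X \ (I ∩ X)).card ≤ size V := (Finset.card_le_card Finset.sdiff_subset).trans hX
  have := Nat.mul_le_mul_left (107 * size V ^ 2) hle
  simp only at hB
  nlinarith

/-- The vertices from which `U` can be reached in at most `k` steps. -/
def layer (G : GameGraph V) (X U : Finset V) : ℕ → Finset V
  | 0 => U
  | k + 1 => layer G X U k ∪
      Finset.univ.filter fun v => v ∈ X ∧ ∃ w ∈ layer G X U k, G.adj v w = true

theorem layer_mono (G : GameGraph V) (X U : Finset V) : Monotone (layer G X U) :=
  monotone_nat_of_le_succ fun _ => Finset.subset_union_left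

theorem layer_subset (G : GameGraph V) {X U : Finset V} (hU : U ⊆ X) (k : ℕ) :
    layer G X U k ⊆ X := by
  induction k with
  | zero => exact hU
  | succ k ih => exact Finset.union_subset ih fun v hv => (Finset.mem_filter.1 hv).2.1

/-- The edges that stay inside `U` or come closer to `U`. -/
def Approaches (G : GameGraph V) (X U : Finset V) (e : V × V) : Prop :=
  (e.1 ∈ U ∧ e.2 ∈ U) ∨ ∃ j, e.2 ∈ layer G X U j ∧ e.1 ∉ layer G X U j

/-- A vertex outside `U` first appears in some layer `m + 1`, and the edge that put it there leads
into layer `m`. -/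
theorem exists_approaches {G : GameGraph V} {X U : Finset V} (hU : U ⊆ X)
    (hsucc : ∀ v ∈ U, ∃ w ∈ U, G.adj v w = true)
    (hreach : ∀ v ∈ X, ∃ u ∈ U, Reaches G X v u) {v : V} (hv : v ∈ X) :
    ∃ w ∈ X, G.adj v w = true ∧ Approaches G X U (v, w) := by
  by_cases hvU : v ∈ U
  · obtain ⟨w, hw, hvw⟩ := hsucc v hvU
    exact ⟨w, hU hw, hvw, .inl ⟨hvU, hw⟩⟩
  have hex : ∃ k, v ∈ layer G X U k := by
    obtain ⟨u, hu, hr⟩ := hreach v hv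
    clear hv hvU
    induction hr using Relation.ReflTransGen.head_induction_on with
    | refl => exact ⟨0, hu⟩
    | head hab _ ih =>
      obtain ⟨k, hk⟩ := ih
      exact ⟨k + 1, Finset.mem_union_right _
        (Finset.mem_filter.2 ⟨Finset.mem_univ _, hab.1, _, hk, hab.2.2⟩)⟩
  have hmin := fun m => Nat.find_min hex (m := m)
  have hspec := Nat.find_spec hex
  generalize Nat.find hex = k at hmin hspec
  cases k with
  | zero => exact absurd hspec hvU
  | succ m =>
    have hm := hmin m (Nat.lt_succ_self m)
    rcases Finset.mem_union.1 hspec with h | h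
    · exact absurd h hm
    · obtain ⟨w, hw, hvw⟩ := (Finset.mem_filter.1 h).2.2
      exact ⟨w, layer_subset G hU m hw, hvw, .inr ⟨m, hw, hm⟩⟩

/-- A co-live edge either leaves some layer `k`, going away from `U`, or joins two vertices of equal
distance from `U`. Neither kind approaches `U`. Reachability makes every iteration add a vertex. -/
theorem exists_runsWithin_coLive (G : GameGraph V) {X U : Finset V} (i : Fin 2) (hU : U ⊆ X)
    (hsucc : ∀ v ∈ U, ∃ w ∈ U, G.adj v w = true)
    (hreach : ∀ v ∈ X, ∃ u ∈ U, Reaches G X v u) :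
    ∃ Ds Da, (coLive G X U i).RunsWithin (Ds, Da) (100 * size V ^ 3) ∧
      (∀ e ∈ Ds, ¬Approaches G X U e) ∧ ∀ e ∈ Da, ¬Approaches G X U e := by
  have hsq := size_le_sq V
  have hone := one_le_size V
  have hcube := size_pow_le_pow V (show 2 ≤ 3 by norm_num)
  have houter : ∀ k, ∀ e ∈ Finset.univ.filter fun e : V × V =>
      e.1 ∈ layer G X U k ∧ e.2 ∈ X \ layer G X U k ∧ G.adj e.1 e.2 = true,
      ¬Approaches G X U e := by
    -- If the target enters layer `j` before the source does, then `j ≤ k` contradicts that the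
    -- target is outside layer `k`, and `k ≤ j` that the source is inside.
    rintro k e he (⟨-, h₂⟩ | ⟨j, h₂, h₁⟩) <;>
      simp only [Finset.mem_filter, Finset.mem_univ, true_and, Finset.mem_sdiff] at he
    · exact he.2.1.2 (layer_mono G X U (Nat.zero_le k) h₂)
    · rcases le_total j k with hjk | hjk
      · exact he.2.1.2 (layer_mono G X U hjk h₂)
      · exact h₁ (layer_mono G X U hjk he.1)
  obtain ⟨D, B, hr, hB, hD⟩ := exists_runsWithin_iterate
    (f := fun s : Finset V × Finset (V × V) => do
      let (U, D) := s
      if ← eqV U X then return Sum.inl D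
      else
        let N ← diffV (← pre G X U) U
        let D ← unionE D (← edgesBetween G N N)
        let U ← unionV U N
        let D ← unionE D (← edgesBetween G U (← diffV X U))
        return Sum.inr (U, D))
    (I := fun s => (∃ k, s.1 = layer G X U k) ∧ ∀ e ∈ s.2, ¬Approaches G X U e)
    (Q := fun D => ∀ e ∈ D, ¬Approaches G X U e)
    (μ := fun s => 50 * size V ^ 2 * (X \ s.1).card + 4 * size V)
    (φ := fun _ => 0)
    (by
      rintro ⟨A, D⟩ ⟨⟨k, hA⟩, hD⟩
      simp only at hA hD
      subst hA
      by_cases heq : layer G X U k = X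
      · left
        refine ⟨_, _, (runsWithin_eqV _ X).bind <| by
          rw [decide_eq_true heq, if_pos rfl]
          exact runsWithin_pure _, ?_, hD⟩
        simp
      · right
        set N := (Finset.univ.filter fun v => v ∈ X ∧ ∃ w ∈ layer G X U k, G.adj v w = true) \
          layer G X U k with hN
        have hU' : layer G X U k ∪ N = layer G X U (k + 1) := Finset.union_sdiff_self_eq_union
        have hpos : 0 < (layer G X U (k + 1) \ layer G X U k).card := by
          obtain ⟨a, haX, haU, b, hb, hab⟩ := exists_adj_into
            (layer_mono G X U (Nat.zero_le k)) (layer_subset G hU k) hreach heq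
          refine Finset.card_pos.2 ⟨a, Finset.mem_sdiff.2 ⟨?_, haU⟩⟩
          exact Finset.mem_union_right _
            (Finset.mem_filter.2 ⟨Finset.mem_univ _, haX, b, hb, hab⟩)
        have hcard := card_sdiff_eq_add (layer_mono G X U (Nat.le_succ k))
          (layer_subset G hU (k + 1))
        have hun := runsWithin_unionV (layer G X U k) N
        rw [hU'] at hun
        refine ⟨_, _, (runsWithin_eqV _ X).bind <| by
          rw [decide_eq_false heq, if_neg (by simp)]
          exact (runsWithin_pre G X _).bind <| (runsWithin_diffV _ _).bind <|
            (runsWithin_edgesBetween G N N).bind <| (runsWithin_unionE D _).bind <|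
            hun.bind <| (runsWithin_diffV X _).bind <| (runsWithin_edgesBetween G _ _).bind <|
            (runsWithin_unionE _ _).bind <| runsWithin_pure _, ?_, ⟨k + 1, rfl⟩, ?_⟩
        · simp only
          rw [Nat.succ_eq_add_one] at hcard
          rw [hcard]
          nlinarith [Nat.mul_le_mul_left (50 * size V ^ 2) hpos]
        · intro e he
          simp only [Finset.mem_union] at he
          rcases he with (he | he) | he
          · exact hD e he
          · simp only [Finset.mem_filter, Finset.mem_univ, true_and] at he
            have h₁ := Finset.mem_sdiff.1 he.1
            have h₂ := Finset.mem_sdiff.1 he.2.1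
            rintro (⟨-, h⟩ | ⟨j, hj₂, hj₁⟩)
            · exact h₂.2 (layer_mono G X U (Nat.zero_le k) h)
            -- Both ends lie in layer `k + 1` but not in layer `k`, so no layer separates them.
            · rcases Nat.lt_or_ge k j with hkj | hkj
              · exact hj₁ (layer_mono G X U hkj (Finset.mem_union_right _ h₁.1))
              · exact h₂.2 (layer_mono G X U hkj hj₂)
          · exact houter (k + 1) e he)
    (U, Finset.univ.filter fun e : V × V => e.1 ∈ U ∧ e.2 ∈ X \ U ∧ G.adj e.1 e.2 = true)
    ⟨⟨0, rfl⟩, houter 0⟩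
  refine ⟨_, _, RunsWithin.mono ((runsWithin_coopSafety G hU hsucc).bind <|
    (runsWithin_diffV X U).bind <| (runsWithin_edgesBetween G U _).bind <| hr.bind <|
    (runsWithin_edgesFrom G i D).bind <| (runsWithin_edgesFrom G (1 - i) D).bind <|
    runsWithin_pure _) ?_, fun e he => hD e (Finset.filter_subset _ _ he),
    fun e he => hD e (Finset.filter_subset _ _ he)⟩
  have hX : X.card ≤ size V := (Finset.card_le_univ X).trans (Nat.le_succ _)
  have hle : (X \ U).card ≤ size V := (Finset.card_le_card Finset.sdiff_subset).trans hX
  have := Nat.mul_le_mul_left (50 * size V ^ 2) hle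
  simp only at hB
  nlinarith

end

section

/-! ## Computation of templates -/

/-- The number of conditions and live-groups in a list of conditional live-groups. -/
def weight {V : Type} (Hs : List (Finset V × List (LiveGroup V))) : ℕ :=
  (Hs.map fun c => c.2.length + 1).sum

variable {V : Type}

/-- All edges of live-groups are edges between vertices of `U`. -/
def GroupsWithin (U : Finset V) (Hs : List (Finset V × List (LiveGroup V))) : Prop :=
  ∀ c ∈ Hs, ∀ H ∈ c.2, H ⊆ U ×ˢ U

theorem GroupsWithin.cons {U X R : Finset V} {Hs : List (Finset V × List (LiveGroup V))}
    {hs : List (LiveGroup V)} (h : GroupsWithin U Hs) (hX : X ⊆ U)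
    (hhs : ∀ H ∈ hs, H ⊆ X ×ˢ X) : GroupsWithin U ((R, hs) :: Hs) := by
  intro c hc H hH
  rcases List.mem_cons.1 hc with rfl | hc
  exacts [(hhs H hH).trans (Finset.product_subset_product hX hX), h c hc H hH]

theorem exists_eq_sup {X : Finset V} (hX : X ≠ ∅) (P : V → ℕ) : ∃ v ∈ X, P v = X.sup P := by
  obtain ⟨v, hv, h⟩ := Finset.exists_mem_eq_sup X (Finset.nonempty_iff_ne_empty.2 hX) P
  exact ⟨v, hv, h.symm⟩

/-- The number of priorities other than `0` that occur in `X`. -/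
def priorityCount (X : Finset V) (P : V → ℕ) : ℕ := ((X.image P).erase 0).card

/-- Relabelling may create the priority `0`, which is why `0` is not counted; the priority `d`
disappears and no other one is new. -/
theorem priorityCount_lt {X X' : Finset V} {P P' : V → ℕ} {d : ℕ} (hX : X' ⊆ X) (hd : d ≠ 0)
    (hdX : ∃ v ∈ X, P v = d) (hP : ∀ v, P' v = if P v = d then 0 else P v) :
    priorityCount X' P' < priorityCount X P := by
  refine Finset.card_lt_card ((Finset.ssubset_iff_of_subset ?_).2 ⟨d, ?_, ?_⟩)
  · intro x hx
    simp only [Finset.mem_erase, Finset.mem_image, hP] at hx ⊢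
    obtain ⟨hx0, v, hv, hvx⟩ := hx
    split_ifs at hvx with h
    · exact absurd hvx.symm hx0
    · exact ⟨hx0, v, hX hv, hvx⟩
  · simpa [hd] using hdX
  · simp only [Finset.mem_erase, Finset.mem_image, hP, not_and, not_exists]
    intro _ v _
    split_ifs with h
    · exact fun h => hd h.symm
    · exact h

variable [Fintype V]

theorem priorityCount_lt_size (X : Finset V) (P : V → ℕ) : priorityCount X P + 1 ≤ size V := by
  refine Nat.succ_le_succ ?_
  exact (Finset.card_le_card (Finset.erase_subset _ _)).trans <|
    Finset.card_image_le.trans (Finset.card_le_univ X)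

variable [DecidableEq V]

/-- `coLive` stops because no winning cycle uses the odd maximum, so every vertex reaches the region
that wins without it. That region is also the invariant set for the next step. -/
theorem exists_runsWithin_oddCase (G : GameGraph V) (i : Fin 2) (s : SetsState V)
    (hs : CoopWinning G s.X s.P) (hd : Odd (s.X.sup s.P)) :
    ∃ W Ds Da, (oddCase G i (s.X.sup s.P) s).RunsWithin
        (W, { s with C := s.C ∪ (s.X \ W), Ds := s.Ds ∪ Ds, Da := s.Da ∪ Da }) (200 * size V ^ 3) ∧
      W ⊆ s.X ∧ (∀ v ∈ W, s.P v ≠ s.X.sup s.P) ∧ CoopWinning G W s.P ∧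
      (∀ v ∈ s.X, ∃ u ∈ W, Reaches G s.X v u) ∧
      (∀ e ∈ Ds, ¬Approaches G s.X W e) ∧ ∀ e ∈ Da, ¬Approaches G s.X W e := by
  set d := s.X.sup s.P with hdef
  set Y := s.X.filter fun v => s.P v ≠ d with hYdef
  have hY : ∀ v, v ∈ Y ↔ v ∈ s.X ∧ s.P v ≠ d := fun v => Finset.mem_filter
  have hWY : paritySet G Y s.P ⊆ Y := paritySet_subset G Y s.P
  have hWX : paritySet G Y s.P ⊆ s.X := hWY.trans (Finset.filter_subset _ _)
  have hW := coopWinning_paritySet G Y s.P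
  have hreach : ∀ v ∈ s.X, ∃ u ∈ paritySet G Y s.P, Reaches G s.X v u := fun v hv =>
    hs.exists_reaches hd (fun v hv => Finset.le_sup hv) hY hv
  obtain ⟨Ds, Da, hr, hDs, hDa⟩ := exists_runsWithin_coLive G i hWX
    (fun v hv => hW.exists_adj hv) hreach
  refine ⟨paritySet G Y s.P, Ds, Da, RunsWithin.conv ((runsWithin_filterV_of_iff (U := Y)
    (fun v => (runsWithin_mem v s.X).bind <| (runsWithin_step (decide (s.P v = d))).bind <|
      runsWithin_pure (decide (v ∈ s.X) && !decide (s.P v = d))) (by simp [hY])).bind <|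
    (runsWithin_coopParity G Y s.P).bind <| hr.bind <| (runsWithin_unionE s.Ds Ds).bind <|
    (runsWithin_unionE s.Da Da).bind <| (runsWithin_diffV s.X _).bind <|
    (runsWithin_unionV s.C _).bind <| runsWithin_pure _) rfl ?_, hWX,
    fun v hv => ((hY v).1 (hWY hv)).2, hW, hreach, hDs, hDa⟩
  have := size_le_sq V
  have := size_pow_le_pow V (show 2 ≤ 3 by norm_num)
  nlinarith

/-- Each `l` considered is below the even maximum `d`, so the target set of `live` contains all
vertices of priority `d` in `Wd`; these are reachable from all of `Wd` inside `Wd`, and `live`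
stops. There are at most `n` calls of cubic cost, each adding at most `2 * size V + 1 ≤ 3 * size V`
to the weight. -/
theorem exists_runsWithin_evenCase (G : GameGraph V) (i : Fin 2) (s : SetsState V)
    (hd : Even (s.X.sup s.P)) {X₀ : Finset V} (hX₀ : s.X ⊆ X₀)
    (hHs : GroupsWithin X₀ s.Hs) (hHa : GroupsWithin X₀ s.Ha) :
    ∃ Hs Ha, (evenCase G i (s.X.sup s.P) s).RunsWithin
        (s.X \ buchiSet G s.X (s.X.filter fun v => s.P v = s.X.sup s.P),
          { s with Hs := Hs, Ha := Ha }) (190 * size V ^ 4) ∧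
      GroupsWithin X₀ Hs ∧ GroupsWithin X₀ Ha ∧
      weight Hs ≤ weight s.Hs + 3 * size V ^ 2 ∧ weight Ha ≤ weight s.Ha + 3 * size V ^ 2 := by
  have hone := one_le_size V
  have hsq := size_le_sq V
  have hcube := size_pow_le_pow V (show 2 ≤ 3 by norm_num)
  have hfour := size_pow_le_pow V (show 3 ≤ 4 by norm_num)
  set d := s.X.sup s.P with hdef
  set I := s.X.filter fun v => s.P v = d with hIdef
  have hI : ∀ v, v ∈ I ↔ v ∈ s.X ∧ s.P v = d := fun v => Finset.mem_filter
  set Wd := buchiSet G s.X I with hWd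
  have hWX : Wd ⊆ s.X := buchiSet_subset G s.X I
  obtain ⟨r, hr, ⟨Hs, Ha, rfl, hHs', hHa', hws, hwa⟩⟩ := exists_runsWithin_forEach_vertices
    (V := V) (σ := SetsState V) (B := 128 * size V ^ 3)
    (I := fun rem r => ∃ Hs Ha, r = { s with Hs := Hs, Ha := Ha } ∧ GroupsWithin X₀ Hs ∧
      GroupsWithin X₀ Ha ∧
      weight Hs + 3 * size V * rem.length ≤ weight s.Hs + 3 * size V * Fintype.card V ∧
      weight Ha + 3 * size V * rem.length ≤ weight s.Ha + 3 * size V * Fintype.card V)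
    (body := fun v r => do
      if (← mem v s.X) && (← step (decide (s.P v ≠ 0))) then
        let l ← step (if Odd (s.P v) then s.P v else s.P v - 1)
        let T ← filterV fun w => do
          return (← mem w Wd) && (← step (decide (Even (s.P w)))) &&
            (← step (decide (l < s.P w)))
        let (hs, ha) ← live G Wd T i
        let R ← filterV fun w => do return (← mem w Wd) && (← step (decide (s.P w = l)))
        step { r with Hs := (R, hs) :: r.Hs, Ha := (R, ha) :: r.Ha }
      else step r)
    (by
      rintro v rem r ⟨Hs, Ha, rfl, hHs, hHa, hws, hwa⟩
      simp only [List.length_cons] at hws hwa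
      by_cases hc : v ∈ s.X ∧ s.P v ≠ 0
      -- An odd `l = s.P v` differs from the even `d`; in the other case `s.P v` is nonzero and
      -- subtracting one makes it smaller.
      · have hl : (if Odd (s.P v) then s.P v else s.P v - 1) < d := by
          have hle : s.P v ≤ d := Finset.le_sup hc.1
          split_ifs with ho
          · refine lt_of_le_of_ne hle fun h => ?_
            rw [h] at ho
            exact Nat.not_odd_iff_even.2 hd ho
          · have := hc.2
            omega
        generalize hldef : (if Odd (s.P v) then s.P v else s.P v - 1) = l at hl
        set T := Wd.filter fun w => Even (s.P w) ∧ l < s.P w with hT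
        obtain ⟨hs, ha, hlive, hlen, hlen', hgs, hga⟩ := exists_runsWithin_live G (X := Wd)
          (I := T) i fun w hw => by
            obtain ⟨u, huW, huI, hr⟩ := exists_reaches_buchiSet hw
            have hPu := ((hI u).1 huI).2
            exact ⟨u, Finset.mem_filter.2 ⟨huW, hPu ▸ hd, hPu ▸ hl⟩, huW, hr⟩
        refine ⟨_, RunsWithin.mono ((runsWithin_mem v s.X).bind <|
          (runsWithin_step (decide (s.P v ≠ 0))).bind <| by
            rw [if_pos (by simpa using hc)]
            exact (runsWithin_step l).bind <| (runsWithin_filterV_of_iff (U := T)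
              (fun w => (runsWithin_mem w Wd).bind <|
                (runsWithin_step (decide (Even (s.P w)))).bind <|
                (runsWithin_step (decide (l < s.P w))).bind <|
                runsWithin_pure (decide (w ∈ Wd) && decide (Even (s.P w)) && decide (l < s.P w)))
              (by simp [hT, and_assoc])).bind <| hlive.bind <|
              (runsWithin_filterV_of_iff (U := Wd.filter fun w => s.P w = l)
                (fun w => (runsWithin_mem w Wd).bind <|
                  (runsWithin_step (decide (s.P w = l))).bind <|
                  runsWithin_pure (decide (w ∈ Wd) && decide (s.P w = l))) (by simp)).bind <|
              runsWithin_step _) ?_, _, _, rfl, hHs.cons (hWX.trans hX₀) hgs,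
            hHa.cons (hWX.trans hX₀) hga, ?_, ?_⟩
        · nlinarith
        · simp only [weight, List.map_cons, List.sum_cons] at hws ⊢
          nlinarith
        · simp only [weight, List.map_cons, List.sum_cons] at hwa ⊢
          nlinarith
      · refine ⟨_, RunsWithin.mono ((runsWithin_mem v s.X).bind <|
          (runsWithin_step (decide (s.P v ≠ 0))).bind <| by
            rw [if_neg (by simpa using hc)]
            exact runsWithin_step _) ?_, _, _, rfl, hHs, hHa, ?_, ?_⟩ <;> nlinarith)
    s ⟨s.Hs, s.Ha, rfl, hHs, hHa, by rw [length_vertices], by rw [length_vertices]⟩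
  have hN : 3 * size V * Fintype.card V ≤ 3 * size V ^ 2 := by
    have : Fintype.card V ≤ size V := Nat.le_succ _
    nlinarith
  refine ⟨Hs, Ha, RunsWithin.conv ((runsWithin_filterV_of_iff (U := I)
    (fun v => (runsWithin_mem v s.X).bind <| (runsWithin_step (decide (s.P v = d))).bind <|
      runsWithin_pure (decide (v ∈ s.X) && decide (s.P v = d))) (by simp [hI])).bind <|
    (runsWithin_coopBuchi G s.X I).bind <| (runsWithin_diffV s.X Wd).bind <| hr.bind <|
    runsWithin_pure _) rfl ?_, hHs', hHa', ?_, ?_⟩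
  · nlinarith
  · simp only [List.length_nil] at hws
    omega
  · simp only [List.length_nil] at hwa
    omega

/-- One iteration of `ComputeSets`. -/
noncomputable def computeSetsStep (G : GameGraph V) (i : Fin 2) (s : SetsState V) :
    Comp (SetsState V ⊕ SetsState V) := do
  if ← eqV s.X ∅ then return Sum.inl s
  else
    let d ← maxPriority s.X s.P
    let (Wn, s') ← if Odd d then oddCase G i d s else evenCase G i d s
    if ← step (decide (0 < d)) then
      let Pd ← filterV fun v => step (decide (s.P v = d))
      let P ← setPriority Pd 0 s.P
      return Sum.inr { s' with X := Wn, P := P }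
    else return Sum.inl s'

theorem computeSets_eq (G : GameGraph V) (i : Fin 2) :
    computeSets G i = iterate (computeSetsStep G i) := rfl

theorem runsWithin_computeSetsStep_inr {G : GameGraph V} {i : Fin 2} {s s' : SetsState V}
    {W : Finset V} (hX : s.X ≠ ∅) (hd : 0 < s.X.sup s.P)
    (h : (if Odd (s.X.sup s.P) then oddCase G i (s.X.sup s.P) s
      else evenCase G i (s.X.sup s.P) s).RunsWithin (W, s') (200 * size V ^ 4)) :
    (computeSetsStep G i s).RunsWithin (Sum.inr { s' with
      X := W, P := fun v => if s.P v = s.X.sup s.P then 0 else s.P v }) (215 * size V ^ 4) := by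
  have hP := (runsWithin_setPriority (Finset.univ.filter fun v => s.P v = s.X.sup s.P) 0 s.P).conv
    (a' := fun v => if s.P v = s.X.sup s.P then 0 else s.P v) (by ext v; simp) le_rfl
  have tail : ∀ {c : Comp (Finset V × SetsState V)}, c.RunsWithin (W, s') (200 * size V ^ 4) →
      (c >>= fun r => do
        if ← step (decide (0 < s.X.sup s.P)) then
          let Pd ← filterV fun v => step (decide (s.P v = s.X.sup s.P))
          let P ← setPriority Pd 0 s.P
          return Sum.inr { r.2 with X := r.1, P := P }
        else return Sum.inl r.2).RunsWithin (Sum.inr { s' with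
          X := W, P := fun v => if s.P v = s.X.sup s.P then 0 else s.P v })
        (200 * size V ^ 4 + (1 + (3 * size V + 3 * size V))) := by
    intro c hc
    refine RunsWithin.mono (hc.bind <| (runsWithin_step _).bind <| by
      rw [decide_eq_true hd, if_pos rfl]
      exact (runsWithin_filterV_of_iff
        (U := Finset.univ.filter (fun v => s.P v = s.X.sup s.P))
        (fun v => runsWithin_step (decide (s.P v = s.X.sup s.P))) (by simp)).bind <|
        hP.bind <| runsWithin_pure _) (by omega)
  refine RunsWithin.mono ((runsWithin_eqV s.X ∅).bind <| by
    rw [decide_eq_false hX, if_neg (by simp)]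
    refine (runsWithin_maxPriority s.X s.P).bind (B' := 200 * size V ^ 4 +
      (1 + (3 * size V + 3 * size V))) ?_
    dsimp only
    split_ifs at h ⊢
    exacts [tail h, tail h]) ?_
  have h₀ := one_le_size V
  have h₁ := size_pow_le_pow V (show 1 ≤ 4 by norm_num)
  nlinarith

theorem runsWithin_computeSetsStep_inl {G : GameGraph V} {i : Fin 2} {s s' : SetsState V}
    {W : Finset V} (hX : s.X ≠ ∅) (hd : s.X.sup s.P = 0)
    (h : (evenCase G i (s.X.sup s.P) s).RunsWithin (W, s') (200 * size V ^ 4)) :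
    (computeSetsStep G i s).RunsWithin (Sum.inl s') (215 * size V ^ 4) := by
  refine RunsWithin.mono ((runsWithin_eqV s.X ∅).bind <| by
    rw [decide_eq_false hX, if_neg (by simp)]
    exact (runsWithin_maxPriority s.X s.P).bind <| by
      rw [if_neg (by simp [hd])]
      exact h.bind <| (runsWithin_step _).bind <| by
        rw [decide_eq_false (by omega), if_neg (by simp)]
        exact runsWithin_pure _) ?_
  have h₀ := one_le_size V
  have h₁ := size_pow_le_pow V (show 1 ≤ 4 by norm_num)
  nlinarith

theorem exists_runsWithin_computeSetsStep_odd (G : GameGraph V) (i : Fin 2) {s : SetsState V}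
    (hs : CoopWinning G s.X s.P) (hX : s.X ≠ ∅) (hd : Odd (s.X.sup s.P)) :
    ∃ s', (computeSetsStep G i s).RunsWithin (Sum.inr s') (215 * size V ^ 4) ∧
      s'.X ⊆ s.X ∧ (∀ v ∈ s'.X, s.P v ≠ s.X.sup s.P) ∧ CoopWinning G s'.X s'.P ∧
      priorityCount s'.X s'.P < priorityCount s.X s.P ∧ s'.C = s.C ∪ (s.X \ s'.X) ∧
      s'.Hs = s.Hs ∧ s'.Ha = s.Ha ∧ (∀ v ∈ s.X, ∃ u ∈ s'.X, Reaches G s.X v u) ∧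
      (∀ e ∈ s'.Ds, e ∈ s.Ds ∨ ¬Approaches G s.X s'.X e) ∧
      ∀ e ∈ s'.Da, e ∈ s.Da ∨ ¬Approaches G s.X s'.X e := by
  obtain ⟨W, Ds, Da, hr, hWX, hWd, hW, hreach, hDs, hDa⟩ :=
    exists_runsWithin_oddCase G i s hs hd
  refine ⟨_, runsWithin_computeSetsStep_inr hX hd.pos (.ite_pos hd <|
      hr.mono (Nat.mul_le_mul_left 200 (size_pow_le_pow V (show 3 ≤ 4 by norm_num)))),
    hWX, hWd, hW.congr fun v hv => (if_neg (hWd v hv)).symm,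
    priorityCount_lt hWX hd.pos.ne' (exists_eq_sup hX s.P) fun _ => rfl, rfl, rfl, rfl, hreach,
    fun e he => ?_, fun e he => ?_⟩
  · exact (Finset.mem_union.1 he).imp_right (hDs e)
  · exact (Finset.mem_union.1 he).imp_right (hDa e)

/-- Co-live edges arise only in odd steps, and such a step puts every vertex of the highest
priority, hence at least one vertex, into `C`; this gives the alternative about `Ds` and `Da`. Cost
and weight are bounded through the number of priorities left. -/
theorem exists_runsWithin_computeSets (G : GameGraph V) (i : Fin 2) {s₀ : SetsState V}
    (hs₀ : CoopWinning G s₀.X s₀.P) (hHs₀ : s₀.Hs = []) (hHa₀ : s₀.Ha = []) :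
    ∃ r, (computeSets G i s₀).RunsWithin r (216 * size V ^ 5) ∧ s₀.C ⊆ r.C ∧
      ((r.Ds = s₀.Ds ∧ r.Da = s₀.Da) ∨ ∃ v ∈ s₀.X, v ∈ r.C) ∧
      GroupsWithin s₀.X r.Hs ∧ GroupsWithin s₀.X r.Ha ∧
      weight r.Hs ≤ 3 * size V ^ 3 ∧ weight r.Ha ≤ 3 * size V ^ 3 := by
  have hone := one_le_size V
  have hone4 : 1 ≤ size V ^ 4 := Nat.one_le_pow _ _ hone
  have hle4 := size_pow_le_pow V (show 1 ≤ 4 by norm_num)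
  obtain ⟨r, B, hr, hB, hQ⟩ := exists_runsWithin_iterate (f := computeSetsStep G i)
    (I := fun s => CoopWinning G s.X s.P ∧ s.X ⊆ s₀.X ∧ s₀.C ⊆ s.C ∧
      ((s.Ds = s₀.Ds ∧ s.Da = s₀.Da) ∨ ∃ v ∈ s₀.X, v ∈ s.C) ∧
      GroupsWithin s₀.X s.Hs ∧ GroupsWithin s₀.X s.Ha ∧
      -- The extra unit in the count pays for a final step with highest priority `0`, which
      -- `priorityCount` does not see.
      weight s.Hs + 3 * size V ^ 2 * (priorityCount s.X s.P + 1) ≤ 3 * size V ^ 3 ∧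
      weight s.Ha + 3 * size V ^ 2 * (priorityCount s.X s.P + 1) ≤ 3 * size V ^ 3)
    (Q := fun r => s₀.C ⊆ r.C ∧ ((r.Ds = s₀.Ds ∧ r.Da = s₀.Da) ∨ ∃ v ∈ s₀.X, v ∈ r.C) ∧
      GroupsWithin s₀.X r.Hs ∧ GroupsWithin s₀.X r.Ha ∧
      weight r.Hs ≤ 3 * size V ^ 3 ∧ weight r.Ha ≤ 3 * size V ^ 3)
    (μ := fun s => 216 * size V ^ 4 * (priorityCount s.X s.P + 1)) (φ := fun _ => 0)
    (by
      rintro s ⟨hs, hX₀, hC, hD, hHs, hHa, hws, hwa⟩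
      by_cases hX : s.X = ∅
      · left
        refine ⟨s, _, (runsWithin_eqV s.X ∅).bind <| by
          rw [decide_eq_true hX, if_pos rfl]
          exact runsWithin_pure _, ?_, hC, hD, hHs, hHa, by nlinarith, by nlinarith⟩
        nlinarith
      by_cases hd : Odd (s.X.sup s.P)
      · right
        obtain ⟨s', hr, hX', hne, hs', hlt, hC', hHs', hHa', -⟩ :=
          exists_runsWithin_computeSetsStep_odd G i hs hX hd
        refine ⟨s', _, hr, ?_, hs', hX'.trans hX₀, ?_, .inr ?_, hHs' ▸ hHs, hHa' ▸ hHa, ?_, ?_⟩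
        · nlinarith [Nat.mul_le_mul_left (216 * size V ^ 4) hlt]
        · rw [hC']
          exact hC.trans Finset.subset_union_left
        · obtain ⟨v, hv, hvd⟩ := exists_eq_sup hX s.P
          refine ⟨v, hX₀ hv, hC' ▸ Finset.mem_union_right _ (Finset.mem_sdiff.2 ⟨hv, ?_⟩)⟩
          exact fun h => hne v h hvd
        · rw [hHs']
          nlinarith [Nat.mul_le_mul_left (3 * size V ^ 2) hlt]
        · rw [hHa']
          nlinarith [Nat.mul_le_mul_left (3 * size V ^ 2) hlt]
      · obtain ⟨Hs, Ha, hr, hHs', hHa', hws', hwa'⟩ := exists_runsWithin_evenCase G i s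
          (Nat.not_odd_iff_even.1 hd) hX₀ hHs hHa
        have hr' := hr.mono (Nat.mul_le_mul_right (size V ^ 4) (show 190 ≤ 200 by norm_num))
        by_cases h0 : s.X.sup s.P = 0
        · left
          refine ⟨_, _, runsWithin_computeSetsStep_inl hX h0 hr', ?_, hC, hD, hHs', hHa', ?_, ?_⟩
          · nlinarith
          · simp only
            nlinarith
          · simp only
            nlinarith
        · right
          have hlt := priorityCount_lt
            (X' := s.X \ buchiSet G s.X (s.X.filter fun v => s.P v = s.X.sup s.P))
            Finset.sdiff_subset h0 (exists_eq_sup hX s.P) fun _ => rfl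
          refine ⟨_, _, runsWithin_computeSetsStep_inr hX (Nat.pos_of_ne_zero h0) (.ite_neg hd hr'), ?_,
            hs.sdiff_buchiSet (fun v => Finset.mem_filter) (fun v => Finset.mem_sdiff) fun _ => rfl,
            Finset.sdiff_subset.trans hX₀, hC, hD, hHs', hHa', ?_, ?_⟩
          · simp only
            nlinarith [Nat.mul_le_mul_left (216 * size V ^ 4) hlt]
          · simp only
            nlinarith [Nat.mul_le_mul_left (3 * size V ^ 2) hlt]
          · simp only
            nlinarith [Nat.mul_le_mul_left (3 * size V ^ 2) hlt])
    s₀ (by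
      have hcount := Nat.mul_le_mul_left (3 * size V ^ 2) (priorityCount_lt_size s₀.X s₀.P)
      refine ⟨hs₀, subset_rfl, subset_rfl, .inl ⟨rfl, rfl⟩, ?_, ?_, ?_, ?_⟩
      · simp [hHs₀, GroupsWithin]
      · simp [hHa₀, GroupsWithin]
      · simp only [hHs₀, weight, List.map_nil, List.sum_nil]
        nlinarith
      · simp only [hHa₀, weight, List.map_nil, List.sum_nil]
        nlinarith)
  refine ⟨r, computeSets_eq G i ▸ hr.mono ?_, hQ⟩
  have hcount := Nat.mul_le_mul_left (216 * size V ^ 4) (priorityCount_lt_size s₀.X s₀.P)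
  nlinarith

end

/-! ### Compatibility of templates when nothing is removed or newly marked -/

section

variable {V : Type} [Fintype V] [DecidableEq V]

/-- The template has no unsafe edges, none of its co-live edges stays inside `U` or comes closer to
`U`, and its live-groups consist of edges inside `U`. -/
structure Template.Respects (G : GameGraph V) (X U : Finset V) (Λ : Template V) : Prop where
  S_eq : Λ.S = ∅
  not_approaches : ∀ e ∈ Λ.D, ¬Approaches G X U e
  groupsWithin : GroupsWithin U Λ.H

/-- When `C` avoids `U`, the first step keeps all of `U`, since lost vertices go into `C`. What
follows runs on `U`, so the live-groups lie inside `U`; a further odd step would put a vertex of `U`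
into `C`, so all co-live edges come from the first step. -/
theorem exists_runsWithin_computeSets_of_odd (G : GameGraph V) (i : Fin 2) {s : SetsState V}
    (hs : CoopWinning G s.X s.P) (hX : s.X ≠ ∅) (hd : Odd (s.X.sup s.P)) (hDs : s.Ds = ∅)
    (hDa : s.Da = ∅) (hHs : s.Hs = []) (hHa : s.Ha = []) :
    ∃ r, (computeSets G i s).RunsWithin r (431 * size V ^ 5) ∧
      weight r.Hs ≤ 3 * size V ^ 3 ∧ weight r.Ha ≤ 3 * size V ^ 3 ∧ (∃ v ∈ s.X, v ∈ r.C) ∧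
      ∀ U, (∀ v, v ∈ U ↔ v ∈ s.X ∧ s.P v ≠ s.X.sup s.P) → Disjoint U r.C →
        (∀ e ∈ r.Ds, ¬Approaches G s.X U e) ∧ (∀ e ∈ r.Da, ¬Approaches G s.X U e) ∧
        GroupsWithin U r.Hs ∧ GroupsWithin U r.Ha ∧
        ∀ v ∈ s.X, ∃ w ∈ s.X, G.adj v w = true ∧ Approaches G s.X U (v, w) := by
  obtain ⟨s', hr, hX', hne, hs', -, hC', hHs', hHa', hreach, hDs', hDa'⟩ :=
    exists_runsWithin_computeSetsStep_odd G i hs hX hd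
  obtain ⟨r, hr', hC, hD, hgs, hga, hws, hwa⟩ :=
    exists_runsWithin_computeSets G i hs' (hHs'.trans hHs) (hHa'.trans hHa)
  rw [computeSets_eq] at hr' ⊢
  refine ⟨r, (hr.iterate_inr hr').mono ?_, hws, hwa, ?_, fun U hU hdisj => ?_⟩
  · have := size_pow_le_pow V (show 4 ≤ 5 by norm_num)
    omega
  · obtain ⟨v, hv, hvd⟩ := exists_eq_sup hX s.P
    refine ⟨v, hv, hC (hC' ▸ Finset.mem_union_right _ (Finset.mem_sdiff.2 ⟨hv, ?_⟩))⟩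
    exact fun h => hne v h hvd
  have hUX' : s'.X = U := by
    ext v
    rw [hU]
    refine ⟨fun hv => ⟨hX' hv, hne v hv⟩, fun hv => ?_⟩
    by_contra hv'
    refine Finset.disjoint_left.1 hdisj ((hU v).2 hv) (hC ?_)
    exact hC' ▸ Finset.mem_union_right _ (Finset.mem_sdiff.2 ⟨hv.1, hv'⟩)
  rw [hUX'] at hs' hgs hga hreach hDs' hDa' hD
  have hUX : U ⊆ s.X := fun v hv => ((hU v).1 hv).1
  have hDs'' : ∀ e ∈ s'.Ds, ¬Approaches G s.X U e := fun e he =>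
    (hDs' e he).resolve_left (by simp [hDs])
  have hDa'' : ∀ e ∈ s'.Da, ¬Approaches G s.X U e := fun e he =>
    (hDa' e he).resolve_left (by simp [hDa])
  rcases hD with ⟨h₁, h₂⟩ | ⟨v, hv, hvC⟩
  · rw [h₁, h₂]
    exact ⟨hDs'', hDa'', hgs, hga, fun v hv =>
      exists_approaches hUX (fun v hv => hs'.exists_adj hv) hreach hv⟩
  · exact absurd hvC (Finset.disjoint_left.1 hdisj hv)

theorem runsWithin_unsafeEdges (G : GameGraph V) {X U : Finset V} (i : Fin 2) (hU : U ⊆ X)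
    (hsucc : ∀ v ∈ U, ∃ w ∈ U, G.adj v w = true) :
    ∃ Ss Sa, (unsafeEdges G X U i).RunsWithin (Ss, Sa) (40 * size V ^ 2) ∧
      (U = X → Ss = ∅ ∧ Sa = ∅) := by
  refine ⟨_, _, RunsWithin.mono ((runsWithin_coopSafety G hU hsucc).bind <|
    (runsWithin_diffV X U).bind <| (runsWithin_edgesBetween G U _).bind <|
    (runsWithin_edgesFrom G i _).bind <| (runsWithin_edgesFrom G (1 - i) _).bind <|
    runsWithin_pure _) ?_, ?_⟩
  · have := size_le_sq V
    omega
  · rintro rfl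
    simp

/-- `M` plays the role of the set of vertices already marked with the highest priority `k`. The
conclusion for an unproductive call mentions only `X \ M`, neither the player nor the priorities,
and so can be combined across the two players. -/
theorem exists_runsWithin_parityTemp (G : GameGraph V) (X : Finset V) (P : V → ℕ) (i : Fin 2) :
    ∃ r, (parityTemp G X P i).RunsWithin r (531 * size V ^ 5) ∧ r.W ⊆ X ∧
      weight r.strat.H ≤ 3 * size V ^ 3 ∧ weight r.assum.H ≤ 3 * size V ^ 3 ∧
      ∀ M k, Odd k → (∀ v, if v ∈ M then P v = k else P v < k) → X ⊆ r.W → r.C ⊆ M →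
        r.strat.Respects G X (X \ M) ∧ r.assum.Respects G X (X \ M) ∧
        ∀ v ∈ X, ∃ w ∈ X, G.adj v w = true ∧ Approaches G X (X \ M) (v, w) := by
  have h3 := size_pow_le_pow V (show 3 ≤ 5 by norm_num)
  have h2 := size_pow_le_pow V (show 2 ≤ 5 by norm_num)
  have hZ := coopWinning_paritySet G X P
  have hZX := paritySet_subset G X P
  have hpar := runsWithin_coopParity G X P
  set Z := paritySet G X P with hZdef
  obtain ⟨Ss, Sa, hS, hS₀⟩ := runsWithin_unsafeEdges G i hZX fun v hv => hZ.exists_adj hv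
  set s₀ : SetsState V := { X := Z, P := P, C := ∅, Ds := ∅, Da := ∅, Hs := [], Ha := [] }
    with hs₀
  have run : ∀ {r : SetsState V}, (computeSets G i s₀).RunsWithin r (431 * size V ^ 5) →
      (parityTemp G X P i).RunsWithin
        { W := Z, C := r.C, strat := ⟨Ss, r.Ds, r.Hs⟩, assum := ⟨Sa, r.Da, r.Ha⟩ }
        (531 * size V ^ 5) := fun hr =>
    RunsWithin.mono (hpar.bind <| hS.bind <| hr.bind <| runsWithin_pure _) (by omega)
  have hsup : ∀ (M : Finset V) k, (∀ v, if v ∈ M then P v = k else P v < k) → X ⊆ Z →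
      (∃ v ∈ X, v ∈ M) → Z.sup P = k := by
    rintro M k hM hXZ ⟨v, hvX, hvM⟩
    refine le_antisymm (Finset.sup_le fun w _ => ?_) ?_
    · have := hM w
      split_ifs at this <;> omega
    · have := hM v
      rw [if_pos hvM] at this
      exact this ▸ Finset.le_sup (f := P) (hXZ hvX)
  by_cases hodd : Z ≠ ∅ ∧ Odd (Z.sup P)
  · obtain ⟨r, hr, hws, hwa, ⟨v, hvZ, hvC⟩, h⟩ :=
      exists_runsWithin_computeSets_of_odd G i (s := s₀) hZ hodd.1 hodd.2 rfl rfl rfl rfl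
    refine ⟨_, run hr, hZX, hws, hwa, fun M k hk hM hXZ hCM => ?_⟩
    have hZX' : Z = X := subset_antisymm hZX hXZ
    -- An odd first step puts some vertex into `C`, hence into `M`; so `M` meets `X` and the highest
    -- priority is `k`.
    have hk' := hsup M k hM hXZ ⟨v, hZX hvZ, hCM hvC⟩
    obtain ⟨hSs, hSa⟩ := hS₀ hZX'
    obtain ⟨h₁, h₂, h₃, h₄, h₅⟩ := h (X \ M) (fun v => by
      have := hM v
      rw [Finset.mem_sdiff]
      change _ ↔ v ∈ Z ∧ P v ≠ Z.sup P
      rw [hk', hZX']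
      split_ifs at this with hv
      · simp [hv, this]
      · simp [hv, this.ne]) (Finset.disjoint_of_subset_right hCM Finset.sdiff_disjoint)
    simp only [hs₀, hZX'] at h₁ h₂ h₅
    exact ⟨⟨hSs, h₁, h₃⟩, ⟨hSa, h₂, h₄⟩, h₅⟩
  · obtain ⟨r, hr, -, hD, hgs, hga, hws, hwa⟩ :=
      exists_runsWithin_computeSets G i (s₀ := s₀) hZ rfl rfl
    refine ⟨_, run (hr.mono (Nat.mul_le_mul_right _ (by norm_num))), hZX, hws, hwa,
      fun M k hk hM hXZ hCM => ?_⟩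
    have hZX' : Z = X := subset_antisymm hZX hXZ
    obtain ⟨hSs, hSa⟩ := hS₀ hZX'
    -- A marked vertex in `X` would make the highest priority the odd number `k`.
    have hMX : ∀ v ∈ X, v ∉ M := fun v hv hvM => hodd
      ⟨Finset.ne_empty_of_mem (hXZ hv), hsup M k hM hXZ ⟨v, hv, hvM⟩ ▸ hk⟩
    have hXM : X \ M = X := Finset.sdiff_eq_self_of_disjoint (Finset.disjoint_left.2 hMX)
    rw [hXM]
    rcases hD with ⟨hDs, hDa⟩ | ⟨v, hvX, hvC⟩
    · refine ⟨⟨hSs, by simp [hDs, hs₀], hZX' ▸ hgs⟩, ⟨hSa, by simp [hDa, hs₀], hZX' ▸ hga⟩,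
        fun v hv => ?_⟩
      rw [hZX'] at hZ
      obtain ⟨w, hw, hvw⟩ := hZ.exists_adj hv
      exact ⟨w, hw, hvw, .inl ⟨hv, hw⟩⟩
    · exact absurd (hCM hvC) (hMX v (hZX hvX))

/-! ## Negotiation -/

theorem weight_append {V : Type} (Hs Hs' : List (Finset V × List (LiveGroup V))) :
    weight (Hs.reverse ++ Hs') = weight Hs + weight Hs' := by
  simp [weight, List.sum_reverse]

theorem length_le_weight {V : Type} (Hs : List (Finset V × List (LiveGroup V))) :
    Hs.length ≤ weight Hs := by
  induction Hs with
  | nil => simp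
  | cons c Hs ih =>
    simp only [weight, List.length_cons, List.map_cons, List.sum_cons] at *
    omega

theorem runsWithin_conj (Λ Λ' : Template V) :
    (conj Λ Λ').RunsWithin ⟨Λ.S ∪ Λ'.S, Λ.D ∪ Λ'.D, Λ.H.reverse ++ Λ'.H⟩
      (10 * size V ^ 2 + 2 * weight Λ.H + 1) := by
  refine RunsWithin.mono ((runsWithin_unionE Λ.S Λ'.S).bind <|
    (runsWithin_unionE Λ.D Λ'.D).bind <| (runsWithin_append Λ.H Λ'.H).bind <|
    runsWithin_pure _) ?_
  have := length_le_weight Λ.H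
  omega

theorem runsWithin_allowed {V : Type} [DecidableEq V] (Λ : Template V) (v w : V) :
    (allowed Λ v w).RunsWithin (!decide ((v, w) ∈ Λ.D) && !decide ((v, w) ∈ Λ.S)) 2 := by
  refine RunsWithin.mono ((runsWithin_mem (v, w) Λ.D).bind <|
    (runsWithin_mem (v, w) Λ.S).bind <| runsWithin_pure _) (by norm_num)

theorem runsWithin_exists_allowed (G : GameGraph V) (X : Finset V) (Λ : Template V) :
    (allIn (vertices V) fun v => do
      let x ← mem v X
      let e ← anyIn (vertices V) fun w => do
        return (← mem w X) && (← edge G v w) && (← allowed Λ v w)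
      return !x || e).RunsWithin
      (decide (∀ v ∈ X, ∃ w ∈ X, G.adj v w = true ∧ (v, w) ∉ Λ.D ∧ (v, w) ∉ Λ.S))
      (9 * size V ^ 2) := by
  refine RunsWithin.conv (runsWithin_allIn_vertices fun v => (runsWithin_mem v X).bind <|
    RunsWithin.bind (runsWithin_anyIn_vertices fun w => (runsWithin_mem w X).bind <|
      (runsWithin_edge G v w).bind <| (runsWithin_allowed Λ v w).bind <|
      runsWithin_pure _) <| runsWithin_pure _) ?_ ?_
  · rw [Bool.eq_iff_iff, decide_eq_true_iff, decide_eq_true_iff]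
    refine forall_congr' fun v => ?_
    by_cases hv : v ∈ X <;> simp [hv, and_assoc]
  · nlinarith [size_le_sq V]

theorem runsWithin_liveGroup_allowed (Λ : Template V) (H : LiveGroup V) :
    (allIn (vertices V) fun v => do
      let source ← anyIn (vertices V) fun w => mem (v, w) H
      let e ← anyIn (vertices V) fun w => do return (← mem (v, w) H) && (← allowed Λ v w)
      return !source || e).RunsWithin
      (decide (∀ v w, (v, w) ∈ H → ∃ w, (v, w) ∈ H ∧ (v, w) ∉ Λ.D ∧ (v, w) ∉ Λ.S))
      (10 * size V ^ 2) := by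
  refine RunsWithin.conv (runsWithin_allIn_vertices fun v =>
    RunsWithin.bind (runsWithin_anyIn_vertices fun w => runsWithin_mem (v, w) H) <|
    RunsWithin.bind (runsWithin_anyIn_vertices fun w => (runsWithin_mem (v, w) H).bind <|
      (runsWithin_allowed Λ v w).bind <| runsWithin_pure _) <| runsWithin_pure _) ?_ ?_
  · rw [Bool.eq_iff_iff, decide_eq_true_iff, decide_eq_true_iff]
    refine forall_congr' fun v => ?_
    by_cases hv : ∃ w, (v, w) ∈ H
    · obtain ⟨w, hw⟩ := hv
      have : ∀ {p : Prop}, (∀ w, (v, w) ∈ H → p) ↔ p := fun {p} =>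
        ⟨fun h => h w hw, fun h _ _ => h⟩
      rw [this]
      simp
      exact fun h => absurd hw (h w)
    · simp only [not_exists] at hv
      simp [hv]
  · nlinarith [size_le_sq V]

/-- The sufficient condition asks that every edge of every live-group be allowed, which is more than
the check needs and is what the respected set provides. -/
theorem exists_runsWithin_checkTemplate (G : GameGraph V) (X : Finset V) (Λ : Template V) :
    ∃ b, (checkTemplate G X Λ).RunsWithin b (12 * size V ^ 2 * (weight Λ.H + 1)) ∧
      ((∀ v ∈ X, ∃ w ∈ X, G.adj v w = true ∧ (v, w) ∉ Λ.D ∧ (v, w) ∉ Λ.S) →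
        (∀ c ∈ Λ.H, ∀ H ∈ c.2, ∀ e ∈ H, e ∉ Λ.D ∧ e ∉ Λ.S) → b = true) := by
  have hone := Nat.one_le_pow 2 _ (one_le_size V)
  refine ⟨_, RunsWithin.mono ((runsWithin_exists_allowed G X Λ).bind <|
    RunsWithin.bind (runsWithin_allIn
      (fun c => runsWithin_allIn (fun H => runsWithin_liveGroup_allowed Λ H) c.2) Λ.H) <|
    runsWithin_pure _) ?_, fun h h' => ?_⟩
  · have : (Λ.H.map fun c => (c.2.map fun _ => 10 * size V ^ 2 + 2).sum + 1 + 2).sum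
        ≤ 12 * size V ^ 2 * weight Λ.H := by
      rw [weight, ← List.sum_map_mul_left]
      refine List.sum_le_sum fun c _ => ?_
      rw [List.map_const', List.sum_replicate, smul_eq_mul]
      nlinarith
    nlinarith
  · simp only [Bool.and_eq_true, decide_eq_true_eq, List.all_eq_true]
    exact ⟨h, fun c hc H hH v w hvw => ⟨w, hvw, h' c hc H hH _ hvw⟩⟩

/-- A conjunction of templates that respect the same set passes the check. -/
theorem Template.Respects.check {G : GameGraph V} {X U : Finset V} {Λ Λ' : Template V}
    (h : Λ.Respects G X U) (h' : Λ'.Respects G X U)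
    (hX : ∀ v ∈ X, ∃ w ∈ X, G.adj v w = true ∧ Approaches G X U (v, w)) :
    (∀ v ∈ X, ∃ w ∈ X, G.adj v w = true ∧ (v, w) ∉ Λ.D ∪ Λ'.D ∧ (v, w) ∉ Λ.S ∪ Λ'.S) ∧
      ∀ c ∈ Λ.H.reverse ++ Λ'.H, ∀ H ∈ c.2, ∀ e ∈ H, e ∉ Λ.D ∪ Λ'.D ∧ e ∉ Λ.S ∪ Λ'.S := by
  have hallowed : ∀ e, Approaches G X U e → e ∉ Λ.D ∪ Λ'.D ∧ e ∉ Λ.S ∪ Λ'.S := by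
    intro e he
    rw [h.S_eq, h'.S_eq]
    refine ⟨fun hmem => ?_, by simp⟩
    rcases Finset.mem_union.1 hmem with hmem | hmem
    exacts [h.not_approaches e hmem he, h'.not_approaches e hmem he]
  constructor
  · intro v hv
    obtain ⟨w, hw, hvw, ha⟩ := hX v hv
    exact ⟨w, hw, hvw, hallowed _ ha⟩
  · intro c hc H hH e he
    -- Live-group edges have both ends in `U`, and such edges count as approaching.
    refine hallowed e (.inl ?_)
    rw [List.mem_append, List.mem_reverse] at hc
    rcases hc with hc | hc
    exacts [Finset.mem_product.1 (h.groupsWithin c hc H hH he),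
      Finset.mem_product.1 (h'.groupsWithin c hc H hH he)]

theorem exists_runsWithin_checkTemplate_conj (G : GameGraph V) (X U : Finset V)
    {Λ Λ' : Template V} (hw : weight Λ.H ≤ 3 * size V ^ 3) (hw' : weight Λ'.H ≤ 3 * size V ^ 3) :
    ∃ Λc b, (conj Λ Λ').RunsWithin Λc (17 * size V ^ 5) ∧
      (checkTemplate G X Λc).RunsWithin b (84 * size V ^ 5) ∧
      (Λ.Respects G X U → Λ'.Respects G X U →
        (∀ v ∈ X, ∃ w ∈ X, G.adj v w = true ∧ Approaches G X U (v, w)) → b = true) := by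
  have h₂ := size_pow_le_pow V (show 2 ≤ 5 by norm_num)
  have h₃ := size_pow_le_pow V (show 3 ≤ 5 by norm_num)
  have hone := Nat.one_le_pow 5 _ (one_le_size V)
  obtain ⟨b, hb, hcheck⟩ := exists_runsWithin_checkTemplate G X
    ⟨Λ.S ∪ Λ'.S, Λ.D ∪ Λ'.D, Λ.H.reverse ++ Λ'.H⟩
  refine ⟨_, b, (runsWithin_conj Λ Λ').mono (by omega), hb.mono ?_, fun h h' hX => ?_⟩
  · simp only [weight_append]
    have hmul : 12 * size V ^ 2 * (weight Λ.H + weight Λ'.H + 1)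
        ≤ 12 * size V ^ 2 * (6 * size V ^ 3 + 1) := Nat.mul_le_mul_left _ (by omega)
    have heq : 12 * size V ^ 2 * (6 * size V ^ 3 + 1) = 72 * size V ^ 5 + 12 * size V ^ 2 := by
      ring
    omega
  · obtain ⟨h₁, h₂⟩ := h.check h' hX
    exact hcheck h₁ h₂

/-- The number of negotiation rounds that may still follow. -/
def remaining (k : ℕ) (s : Finset V × (V → ℕ) × (V → ℕ)) : ℕ :=
  s.1.card + (Finset.univ.filter fun v => s.2.1 v = k)ᶜ.card

/-- The hypothesis says that a vertex is marked for both players or for neither, so a single set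
`M`, read off from `P₀`, describes both priority functions, and marked priorities exceed all others.
-/
theorem exists_runsWithin_negotiationRound (G : GameGraph V) (d₀ d₁ : ℕ)
    (s : Finset V × (V → ℕ) × (V → ℕ))
    (hs : ∀ v, (s.2.1 v = 2 * d₀ + 1 ∧ s.2.2 v = 2 * d₁ + 1) ∨ (s.2.1 v ≤ d₀ ∧ s.2.2 v ≤ d₁)) :
    (∃ b, (negotiationRound G d₀ d₁ s).RunsWithin (Sum.inl b) (1316 * size V ^ 5)) ∨
    ∃ s', (negotiationRound G d₀ d₁ s).RunsWithin (Sum.inr s') (1316 * size V ^ 5) ∧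
      remaining (2 * d₀ + 1) s' < remaining (2 * d₀ + 1) s ∧
      ∀ v, (s'.2.1 v = 2 * d₀ + 1 ∧ s'.2.2 v = 2 * d₁ + 1) ∨ (s'.2.1 v ≤ d₀ ∧ s'.2.2 v ≤ d₁) := by
  obtain ⟨X, P₀, P₁⟩ := s
  simp only at hs
  have h₁₅ := size_pow_le_pow V (show 1 ≤ 5 by norm_num)
  rw [pow_one] at h₁₅
  obtain ⟨r₀, hr₀, hW₀, hs₀, ha₀, hresp₀⟩ := exists_runsWithin_parityTemp G X P₀ 0
  obtain ⟨r₁, hr₁, hW₁, hs₁, ha₁, hresp₁⟩ := exists_runsWithin_parityTemp G X P₁ 1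
  set M := Finset.univ.filter fun v => P₀ v = 2 * d₀ + 1 with hM
  have hmem : ∀ v, v ∈ M ↔ P₀ v = 2 * d₀ + 1 := fun v => by simp [hM]
  obtain ⟨Λ₀, b₀, hconj₀, hb₀, hc₀⟩ :=
    exists_runsWithin_checkTemplate_conj G X (X \ M) ha₁ hs₀
  obtain ⟨Λ₁, b₁, hconj₁, hb₁, hc₁⟩ :=
    exists_runsWithin_checkTemplate_conj G X (X \ M) ha₀ hs₁
  by_cases hb : (b₀ && b₁) = true
  · left
    exact ⟨_, RunsWithin.mono (hr₀.bind <| hr₁.bind <| hconj₀.bind <| hb₀.bind <|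
      hconj₁.bind <| hb₁.bind <| .ite_pos hb <| runsWithin_pure _) (by omega)⟩
  · right
    refine ⟨_, RunsWithin.mono (hr₀.bind <| hr₁.bind <| hconj₀.bind <| hb₀.bind <|
      hconj₁.bind <| hb₁.bind <| .ite_neg hb <| (runsWithin_interV _ _).bind <|
      (runsWithin_unionV _ _).bind <| (runsWithin_setPriority _ _ _).bind <|
      (runsWithin_setPriority _ _ _).bind <| runsWithin_pure _) (by omega), ?_, fun v => ?_⟩
    · have hWX : r₀.W ∩ r₁.W ⊆ X := Finset.inter_subset_left.trans hW₀
      have hMM : (Finset.univ.filter fun v =>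
          (if v ∈ r₀.C ∪ r₁.C then 2 * d₀ + 1 else P₀ v) = 2 * d₀ + 1)ᶜ ⊆ Mᶜ := by
        intro v hv
        simp only [Finset.mem_compl, Finset.mem_filter, Finset.mem_univ, true_and, hmem] at hv ⊢
        split_ifs at hv with h
        · exact absurd rfl hv
        · exact hv
      have hle₁ := Finset.card_le_card hWX
      have hle₂ := Finset.card_le_card hMM
      simp only [remaining, ← hM]
      -- If the measure does not drop, neither summand does: no vertex is removed and `C₀ ∪ C₁` is
      -- already marked. Then all four templates respect `X \ M`, so both checks succeed, against
      -- the assumption.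
      by_contra hlt
      have hW : r₀.W ∩ r₁.W = X := Finset.eq_of_subset_of_card_le hWX (by omega)
      have hC := Finset.eq_of_subset_of_card_le hMM (by omega)
      have hCM : r₀.C ∪ r₁.C ⊆ M := by
        intro v hv
        by_contra hvM
        rw [← Finset.mem_compl, ← hC] at hvM
        simp only [Finset.mem_compl, Finset.mem_filter, Finset.mem_univ, true_and] at hvM
        exact hvM (if_pos hv)
      obtain ⟨g₀, g₀', hX₀⟩ := hresp₀ M (2 * d₀ + 1) (odd_two_mul_add_one d₀) (fun v => by
        have := hs v
        split_ifs with hv <;> rw [hmem] at hv <;> omega) (hW ▸ Finset.inter_subset_left)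
        (Finset.subset_union_left.trans hCM)
      obtain ⟨g₁, g₁', -⟩ := hresp₁ M (2 * d₁ + 1) (odd_two_mul_add_one d₁) (fun v => by
        have := hs v
        split_ifs with hv <;> rw [hmem] at hv <;> omega) (hW ▸ Finset.inter_subset_right)
        (Finset.subset_union_right.trans hCM)
      exact hb (by rw [hc₀ g₁' g₀ hX₀, hc₁ g₀' g₁ hX₀]; rfl)
    · by_cases hv : v ∈ r₀.C ∪ r₁.C
      · simp only [if_pos hv]
        exact .inl ⟨trivial, trivial⟩
      · simp only [if_neg hv]
        exact hs v

/-- Input priorities are at most `d₀` and `d₁`, so the invariant holds at the start. The measure, at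
most `2n`, is multiplied by the cost of a round plus one; the one added to the measure covers the
returning round. -/
theorem exists_runsWithin_negotiate (G : GameGraph V) (P₀ P₁ : V → ℕ) :
    ∃ r, (negotiate G P₀ P₁).RunsWithin r (2700 * size V ^ 6) := by
  have h₁₆ := size_pow_le_pow V (show 1 ≤ 6 by norm_num)
  rw [pow_one] at h₁₆
  have hone := Nat.one_le_pow 5 _ (one_le_size V)
  have h₀ : ∀ v, P₀ v ≤ Finset.univ.sup P₀ := fun v => Finset.le_sup (Finset.mem_univ v)
  have h₁ : ∀ v, P₁ v ≤ Finset.univ.sup P₁ := fun v => Finset.le_sup (Finset.mem_univ v)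
  generalize hd₀ : Finset.univ.sup P₀ = d₀ at h₀
  generalize hd₁ : Finset.univ.sup P₁ = d₁ at h₁
  obtain ⟨r, B, hr, hB, -⟩ := exists_runsWithin_iterate (f := negotiationRound G d₀ d₁)
    (I := fun s => ∀ v, (s.2.1 v = 2 * d₀ + 1 ∧ s.2.2 v = 2 * d₁ + 1) ∨
      (s.2.1 v ≤ d₀ ∧ s.2.2 v ≤ d₁))
    (Q := fun _ => True)
    (μ := fun s => 1317 * size V ^ 5 * (remaining (2 * d₀ + 1) s + 1)) (φ := fun _ => 0)
    (fun s hs => by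
      rcases exists_runsWithin_negotiationRound G d₀ d₁ s hs with
        ⟨b, hb⟩ | ⟨s', hr, hlt, hs'⟩
      · refine .inl ⟨b, _, hb, ?_, trivial⟩
        nlinarith
      · refine .inr ⟨s', _, hr, ?_, hs'⟩
        nlinarith [Nat.mul_le_mul_left (1317 * size V ^ 5) hlt])
    (Finset.univ, P₀, P₁) fun v => .inr ⟨h₀ v, h₁ v⟩
  have hmax₀ := runsWithin_maxPriority Finset.univ P₀
  have hmax₁ := runsWithin_maxPriority Finset.univ P₁
  rw [hd₀] at hmax₀
  rw [hd₁] at hmax₁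
  refine ⟨r, RunsWithin.mono ((runsWithin_filterV_of_iff (U := Finset.univ)
    (fun _ => runsWithin_step true) (by simp)).bind <| hmax₀.bind <| hmax₁.bind hr) ?_⟩
  have hrem : remaining (2 * d₀ + 1) (Finset.univ, P₀, P₁) + 1 ≤ 2 * size V := by
    have h₂ := Finset.card_le_univ
      (Finset.univ.filter fun v => P₀ v = 2 * d₀ + 1)ᶜ
    simp only [remaining, size, Finset.card_univ]
    omega
  have hmul := Nat.mul_le_mul_left (1317 * size V ^ 5) hrem
  have heq : 1317 * size V ^ 5 * (2 * size V) = 2634 * size V ^ 6 := by ring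
  omega

end

end Negotiation

theorem mainTheorem2 :
    ∃ K : ℕ, ∀ (V : Type) [Fintype V] [DecidableEq V] (G : Negotiation.GameGraph V)
      (P₀ P₁ : V → ℕ),
      ∃ (result : Negotiation.NegotiateResult V) (t : ℕ),
        (Negotiation.negotiate G P₀ P₁).RunsTo result t ∧
          (0 < Fintype.card V → t ≤ K * Fintype.card V ^ 6) := by
  -- The factor `2 ^ 6` comes from `n + 1 ≤ 2 * n`, valid for `n ≥ 1`.
  refine ⟨2700 * 2 ^ 6, fun V _ _ G P₀ P₁ => ?_⟩
  obtain ⟨r, t, ht, hr⟩ := Negotiation.exists_runsWithin_negotiate G P₀ P₁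
  refine ⟨r, t, hr, fun hV => ht.trans ?_⟩
  have hsize : Negotiation.size V ≤ 2 * Fintype.card V := by
    unfold Negotiation.size
    omega
  calc 2700 * Negotiation.size V ^ 6 ≤ 2700 * (2 * Fintype.card V) ^ 6 :=
        Nat.mul_le_mul_left _ (Nat.pow_le_pow_left hsize 6)
    _ = 2700 * 2 ^ 6 * Fintype.card V ^ 6 := by ring
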